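/- Let \(\Theta\subset\mathbb R^d\) be compact and convex, and for each \(x\) in a measurable space \(\mathcal X\) let \(f(\cdot;x):\Theta\to\mathbb R\) be convex. Let \(X\sim P\) be \(\mathcal X\)-valued, let \(f(\theta;X)\) be integrable for every \(\theta\in\Theta\), put \(F_0(\theta)=\mathbb E[f(\theta;X)]\), and let \(\theta^*\) be the unique minimizer of \(F_0\) over \(\Theta\). Assume: 1. \(\theta^*\in\operatorname{int}\Theta\) and \(\|\theta-\theta^*\|_2\le R\) for all \(\theta\in\Theta\). 2. \(F_0\) is twice differentiable on the ball \(U=\{\theta:\|\theta-\theta^*\|_2<\rho\}\subseteq\Theta\), \(\rho>0\), and \(\nabla^2F_0(\theta^*)\succeq\lambda I_{d\times d}\) for some \(\lambda>0\). 3. For every \(x\), \(f(\cdot;x)\) is twice differentiable on \(U\), and for constants \(G,H,L\ge 0\) and all \(\theta,\theta'\in U\): \(\mathbb E\|\nabla f(\theta;X)\|_2^8\le G^8\); \(\mathbb E\|\nabla^2f(\theta;X)-\nabla^2F_0(\theta)\|_2^8\le H^8\) (operator norm); and \(\|\nabla^2f(\theta';x)-\nabla^2f(\theta;x)\|_2\le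 L(x)\|\theta'-\theta\|_2\) for every \(x\), where \(\mathbb E[L(X)^8]\le L^8\) and \(\mathbb E[(L(X)-\mathbb E L(X))^8]\le L^8\). 4. The losses are the negative log-likelihoods of a parametric family: there are probability measures \(P_\theta\), \(\theta\in\Theta\), with positive densities \(p_\theta\) with respect to a common measure, \(f(\theta;x)=\ell(x\mid\theta):=-\log p_\theta(x)\), and \(P=P_{\theta^*}\). Let \(I(\theta^*)=\mathbb E[\nabla\ell(X\mid\theta^*)\nabla\ell(X\mid\theta^*)^\top]\) be the Fisher information matrix. Distribute \(N=mn\) i.i.d. samples from \(P\) over \(m\ge1\) machines, \(n\ge1\) samples each; let \(\theta_{1,i}\) be a minimizer over \(\Theta\) of the empirical risk of the \(n\) samples of machine \(i\) (a measurable function of these samples), and let \(\bar\theta_1=\frac1m\sum_{i=1}^m\theta_{1,i}\). Then \[ \mathbb E\|\bar\theta_1-\theta^*\|_2^2\le\frac2N\operatorname{tr}\bigl(I(\theta^*)^{-1}\bigr)+\frac{c\,m^2\operatorname{tr}(I(\theta^*)^{-1})}{\lambda^2N^2}\Bigl(H^2\log\max\{d,2\}+\frac{L^2G^2}{\lambda^2}\Bigr)+O(mN^{-2})+O(n^{-3}),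 \] where \(c\) is a numerical constant. The bound holds for all \(m,n\ge1\), and the constants in the order terms depend only on \(d,R,\rho,\lambda,G,H,L\). (In particular, the last term is absorbed in \(O(mN^{-2})\) whenever \(m\le n\).) -/

import Mathlib

open MeasureTheory ProbabilityTheory

noncomputable section

/-- The Hessian of `g : ℝᵈ → ℝ` at `θ`, as a linear operator on `ℝᵈ` (the derivative of the
gradient). Its norm is the `ℓ₂`-operator norm of the Hessian matrix. -/
def hessian {d : ℕ} (g : EuclideanSpace ℝ (Fin d) → ℝ) (θ : EuclideanSpace ℝ (Fin d)) :
    EuclideanSpace ℝ (Fin d) →L[ℝ] EuclideanSpace ℝ (Fin d) :=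
  fderiv ℝ (gradient g) θ

/-- The population risk `F₀(θ) = E_P[f(θ; X)]`. -/
def popRisk {d : ℕ} {𝒳 : Type*} [MeasurableSpace 𝒳]
    (f : EuclideanSpace ℝ (Fin d) → 𝒳 → ℝ) (P : Measure 𝒳)
    (θ : EuclideanSpace ℝ (Fin d)) : ℝ :=
  ∫ x, f θ x ∂P

/-- The empirical risk `(1/n) ∑ⱼ f(θ; sⱼ)` of the data set `s` of size `n`. -/
def empRisk {d n : ℕ} {𝒳 : Type*} (f : EuclideanSpace ℝ (Fin d) → 𝒳 → ℝ)
    (s : Fin n → 𝒳) (θ : EuclideanSpace ℝ (Fin d)) : ℝ :=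
  (1 / (n : ℝ)) * ∑ j, f θ (s j)

/-- Convex, integrable losses on a compact convex parameter set of `ℓ₂`-radius at most `R` around
the unique population risk minimizer `θs`, which is an interior point. -/
structure ParameterAssumption {d : ℕ} {𝒳 : Type*} [MeasurableSpace 𝒳]
    (Θ : Set (EuclideanSpace ℝ (Fin d))) (f : EuclideanSpace ℝ (Fin d) → 𝒳 → ℝ)
    (P : Measure 𝒳) (θs : EuclideanSpace ℝ (Fin d)) (R : ℝ) : Prop where
  isCompact : IsCompact Θ
  convex : Convex ℝ Θ
  convexOn_loss : ∀ x, ConvexOn ℝ Θ (fun θ => f θ x)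
  integrable_loss : ∀ θ ∈ Θ, Integrable (f θ) P
  mem_interior : θs ∈ interior Θ
  isUniqueMin : ∀ θ ∈ Θ, θ ≠ θs → popRisk f P θs < popRisk f P θ
  radius_le : ∀ θ ∈ Θ, ‖θ - θs‖ ≤ R

/-- Local strong convexity: the population risk is twice differentiable (this is asked only on the
open ball of radius `ρ` around `θs`), and `∇²F₀(θs) ⪰ lam • I` with `lam > 0`. -/
structure LocalStrongConvexity {d : ℕ} {𝒳 : Type*} [MeasurableSpace 𝒳]
    (f : EuclideanSpace ℝ (Fin d) → 𝒳 → ℝ) (P : Measure 𝒳)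
    (θs : EuclideanSpace ℝ (Fin d)) (ρ lam : ℝ) : Prop where
  lam_pos : 0 < lam
  differentiableAt : ∀ θ ∈ Metric.ball θs ρ, DifferentiableAt ℝ (popRisk f P) θ
  differentiableAt_gradient : ∀ θ ∈ Metric.ball θs ρ,
    DifferentiableAt ℝ (gradient (popRisk f P)) θ
  curvature : ∀ v : EuclideanSpace ℝ (Fin d),
    lam * ‖v‖ ^ 2 ≤ inner ℝ v (hessian (popRisk f P) θs v)

/-- Smoothness of the losses on the ball `U` of radius `ρ > 0` around `θs`, `U ⊆ Θ`: eighth moment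
bounds for gradients and Hessians, and Hessians that are Lipschitz with a sample dependent constant
that has bounded eighth (raw and central) moments. -/
structure SmoothnessAssumption {d : ℕ} {𝒳 : Type*} [MeasurableSpace 𝒳]
    (Θ : Set (EuclideanSpace ℝ (Fin d))) (f : EuclideanSpace ℝ (Fin d) → 𝒳 → ℝ)
    (P : Measure 𝒳) (θs : EuclideanSpace ℝ (Fin d)) (ρ G H L : ℝ) : Prop where
  rho_pos : 0 < ρ
  ball_subset : Metric.ball θs ρ ⊆ Θ
  G_nonneg : 0 ≤ G
  H_nonneg : 0 ≤ H
  L_nonneg : 0 ≤ L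
  differentiableAt : ∀ x, ∀ θ ∈ Metric.ball θs ρ, DifferentiableAt ℝ (fun η => f η x) θ
  differentiableAt_gradient : ∀ x, ∀ θ ∈ Metric.ball θs ρ,
    DifferentiableAt ℝ (gradient (fun η => f η x)) θ
  gradient_moment : ∀ θ ∈ Metric.ball θs ρ,
    Integrable (fun x => ‖gradient (fun η => f η x) θ‖ ^ 8) P ∧
      ∫ x, ‖gradient (fun η => f η x) θ‖ ^ 8 ∂P ≤ G ^ 8
  hessian_moment : ∀ θ ∈ Metric.ball θs ρ,
    Integrable (fun x => ‖hessian (fun η => f η x) θ - hessian (popRisk f P) θ‖ ^ 8) P ∧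
      ∫ x, ‖hessian (fun η => f η x) θ - hessian (popRisk f P) θ‖ ^ 8 ∂P ≤ H ^ 8
  hessian_lipschitz : ∃ Lip : 𝒳 → ℝ, Measurable Lip ∧
    (∀ x, ∀ θ ∈ Metric.ball θs ρ, ∀ θ' ∈ Metric.ball θs ρ,
      ‖hessian (fun η => f η x) θ' - hessian (fun η => f η x) θ‖ ≤ Lip x * ‖θ' - θ‖) ∧
    (Integrable (fun x => Lip x ^ 8) P ∧ ∫ x, Lip x ^ 8 ∂P ≤ L ^ 8) ∧
    (Integrable (fun x => (Lip x - ∫ y, Lip y ∂P) ^ 8) P ∧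
      ∫ x, (Lip x - ∫ y, Lip y ∂P) ^ 8 ∂P ≤ L ^ 8)

/-- The distribution `P_θ` with density `p θ` with respect to the dominating measure `ν`. -/
def modelMeasure {d : ℕ} {𝒳 : Type*} [MeasurableSpace 𝒳] (ν : Measure 𝒳)
    (p : EuclideanSpace ℝ (Fin d) → 𝒳 → ℝ) (θ : EuclideanSpace ℝ (Fin d)) : Measure 𝒳 :=
  ν.withDensity (fun x => ENNReal.ofReal (p θ x))

/-- `{P_θ : θ ∈ Θ}` is a family of probability distributions with `ν`-densities `p θ`, positive
so that the log-likelihood is real-valued. -/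
structure IsParametricFamily {d : ℕ} {𝒳 : Type*} [MeasurableSpace 𝒳]
    (Θ : Set (EuclideanSpace ℝ (Fin d))) (ν : Measure 𝒳)
    (p : EuclideanSpace ℝ (Fin d) → 𝒳 → ℝ) : Prop where
  measurable : ∀ θ ∈ Θ, Measurable (p θ)
  pos : ∀ θ ∈ Θ, ∀ x, 0 < p θ x
  isProbabilityMeasure : ∀ θ ∈ Θ, IsProbabilityMeasure (modelMeasure ν p θ)

/-- The negative log-likelihood `ℓ(x ∣ θ) = -log p_θ(x)`. -/
def negLogLikelihood {d : ℕ} {𝒳 : Type*} (p : EuclideanSpace ℝ (Fin d) → 𝒳 → ℝ)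
    (θ : EuclideanSpace ℝ (Fin d)) (x : 𝒳) : ℝ :=
  -Real.log (p θ x)

/-- The Fisher information matrix `I(θ) = E_θ[∇ℓ(X ∣ θ) ∇ℓ(X ∣ θ)ᵀ]`. -/
def fisherInformation {d : ℕ} {𝒳 : Type*} [MeasurableSpace 𝒳] (ν : Measure 𝒳)
    (p : EuclideanSpace ℝ (Fin d) → 𝒳 → ℝ) (θ : EuclideanSpace ℝ (Fin d)) :
    Matrix (Fin d) (Fin d) ℝ :=
  Matrix.of fun i j => ∫ x, gradient (fun η => negLogLikelihood p η x) θ i *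
    gradient (fun η => negLogLikelihood p η x) θ j ∂(modelMeasure ν p θ)

/-- `θhat` is an empirical risk minimizer over `Θ` computed from the random data set `S`: a
measurable function of `S` that almost surely lies in `argmin_Θ` of the empirical risk of `S`. -/
structure IsEmpiricalMinimizer {d n : ℕ} {𝒳 Ω : Type*} [MeasurableSpace 𝒳] [MeasurableSpace Ω]
    (Θ : Set (EuclideanSpace ℝ (Fin d))) (f : EuclideanSpace ℝ (Fin d) → 𝒳 → ℝ)
    (μ : Measure Ω) (S : Fin n → Ω → 𝒳) (θhat : Ω → EuclideanSpace ℝ (Fin d)) : Prop where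
  exists_estimator : ∃ T : (Fin n → 𝒳) → EuclideanSpace ℝ (Fin d),
    Measurable T ∧ ∀ ω, θhat ω = T (fun j => S j ω)
  argmin : ∀ᵐ ω ∂μ, θhat ω ∈ Θ ∧ IsMinOn (empRisk f (fun j => S j ω)) Θ (θhat ω)

/-- The average mixture estimate `(1/m) ∑ᵢ θᵢ`. -/
def avgMixture {d m : ℕ} {Ω : Type*} (θhat : Fin m → Ω → EuclideanSpace ℝ (Fin d)) (ω : Ω) :
    EuclideanSpace ℝ (Fin d) :=
  (1 / (m : ℝ)) • ∑ i, θhat i ω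

end

/-! Write `Δ = θ₁ - θ*` for the error of one machine, `S = ∇²F₀(θ*)`, `B = S⁻¹`, and `V = E‖B ∇f(θ*;
X)‖²`. The errors of different machines are independent, so the mean squared error of the average is
at most (single-machine mean squared error)/m plus the squared norm of the single-machine bias
(`integral_norm_average_sq_le`). The bias is not reduced by averaging, which is why the second term
of the bound carries `m²/N² = 1/n²`.

For one machine let `g` be the empirical score at `θ*`, `A` the deviation of the empirical Hessian
at `θ*` from `S`, `ℓ` the centred average of the Lipschitz constants, and `Z = ‖g‖ + ‖A‖ + |ℓ|`,
whose fourth moment is `O(n⁻²)`. If `Z` is below a fixed threshold, convexity places the minimizer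
near `θ*`, and vanishing of the gradient there gives `Δ = -Bg + BABg + r` with `‖r‖ ≤ C Z³ +
λ⁻¹L‖Δ‖²`. If `Z` is above the threshold, boundedness of `Θ` gives the same bounds with larger
constants (`norm_sub_le_of_isMinOn`, `exists_remainder_bounds`).

Taking expectations (`expectation_bounds_of_expansion`), the mean squared error is at most `2V/n +
O(n⁻²)`. In the bias, `Bg` has mean zero. In `E[A B g]` only products from the same sample survive,
which leaves `λ⁻¹H√V/n` without any dimension factor. The quadratic part of `r` contributes
`2λ⁻¹LV/n`, and the rest is `O(n^{-3/2})`. Squaring yields the second term and the `n⁻³` error.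

The likelihood structure enters only through `V ≤ tr I(θ*)⁻¹`. This needs `I(θ*) ≤ S` as quadratic
forms, one half of the information equality, which follows from Fatou's lemma because likelihood
ratios have mean one (`integral_inner_gradient_sq_le`). It also needs `I(θ*)` to be positive
definite, which follows from convexity and uniqueness of the minimizer
(`integral_inner_gradient_sq_pos`). -/

/-! ### Moment inequalities for sums of independent centred variables. -/

section Moments

variable {Ω : Type*} [MeasurableSpace Ω] {μ : Measure Ω}

lemma integrable_pow_of_le [IsFiniteMeasure μ] {Y : Ω → ℝ} (hY : AEStronglyMeasurable Y μ)
    {k n : ℕ} (hkn : k ≤ n) (hn : Integrable (fun ω => Y ω ^ n) μ) :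
    Integrable (fun ω => Y ω ^ k) μ := by
  refine Integrable.mono' ((integrable_const (1 : ℝ)).add hn.norm) (hY.pow k) ?_
  refine Filter.Eventually.of_forall fun ω => ?_
  simp only [norm_pow, Pi.add_apply]
  rcases le_total ‖Y ω‖ 1 with h | h
  · have := pow_le_one₀ (n := k) (norm_nonneg _) h
    have : 0 ≤ ‖Y ω‖ ^ n := by positivity
    linarith
  · have := pow_le_pow_right₀ h hkn
    linarith

lemma sq_integral_le_integral_sq [IsProbabilityMeasure μ] {Y : Ω → ℝ}
    (hY : Integrable Y μ) (hY2 : Integrable (fun ω => Y ω ^ 2) μ) :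
    (∫ ω, Y ω ∂μ) ^ 2 ≤ ∫ ω, Y ω ^ 2 ∂μ := by
  set c := ∫ ω, Y ω ∂μ with hc
  have h : 0 ≤ ∫ ω, (Y ω - c) ^ 2 ∂μ := integral_nonneg fun ω => sq_nonneg _
  have e : ∫ ω, (Y ω - c) ^ 2 ∂μ = ∫ ω, (Y ω ^ 2 - (2 * c) * Y ω + c ^ 2) ∂μ := by
    congr 1; ext ω; ring
  have hs : Integrable (fun ω => Y ω ^ 2 - 2 * c * Y ω) μ := hY2.sub (hY.const_mul _)
  rw [e, integral_add hs (integrable_const _),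
    integral_sub hY2 (hY.const_mul _), integral_const_mul, ← hc] at h
  simp at h
  nlinarith

/-- Eighth moment bounds imply the bounds on lower order moments. -/
lemma moment_le_of_eighth_moment_le [IsProbabilityMeasure μ] {Y : Ω → ℝ} {K : ℝ} (hK : 0 ≤ K)
    (hY : AEStronglyMeasurable Y μ) (h8 : Integrable (fun ω => Y ω ^ 8) μ)
    (hle : ∫ ω, Y ω ^ 8 ∂μ ≤ K ^ 8) :
    ∫ ω, Y ω ^ 4 ∂μ ≤ K ^ 4 ∧ ∫ ω, Y ω ^ 2 ∂μ ≤ K ^ 2 ∧ ∫ ω, Y ω ∂μ ≤ K := by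
  have h4 := integrable_pow_of_le hY (show 4 ≤ 8 by norm_num) h8
  have h2 := integrable_pow_of_le hY (show 2 ≤ 8 by norm_num) h8
  have h1 : Integrable Y μ := by
    simpa using integrable_pow_of_le hY (show 1 ≤ 8 by norm_num) h8
  have a1 := sq_integral_le_integral_sq (Y := fun ω => Y ω ^ 4) h4 (by simpa [← pow_mul] using h8)
  have a2 := sq_integral_le_integral_sq (Y := fun ω => Y ω ^ 2) h2 (by simpa [← pow_mul] using h4)
  have a3 := sq_integral_le_integral_sq h1 h2
  simp only [← pow_mul, Nat.reduceMul] at a1 a2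
  have b1 : ∫ ω, Y ω ^ 4 ∂μ ≤ K ^ 4 :=
    le_of_sq_le_sq (by nlinarith) (by positivity)
  have b2 : ∫ ω, Y ω ^ 2 ∂μ ≤ K ^ 2 :=
    le_of_sq_le_sq (by nlinarith) (by positivity)
  exact ⟨b1, b2, le_of_sq_le_sq (by nlinarith) hK⟩

/-- Fourth moment of a sum of independent centred random variables. -/
lemma fourth_moment_sum_le {ι : Type*} [DecidableEq ι] {Y : ι → Ω → ℝ} {M : ℝ}
    (hind : iIndepFun Y μ) (hmeas : ∀ i, Measurable (Y i)) (hzero : ∀ i, ∫ ω, Y i ω ∂μ = 0)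
    (hint : ∀ i, Integrable (fun ω => Y i ω ^ 4) μ) (hle : ∀ i, ∫ ω, Y i ω ^ 4 ∂μ ≤ M)
    (s : Finset ι) :
    Integrable (fun ω => (∑ i ∈ s, Y i ω) ^ 4) μ ∧
      ∫ ω, (∑ i ∈ s, Y i ω) ^ 2 ∂μ ≤ s.card * √M ∧
      ∫ ω, (∑ i ∈ s, Y i ω) ^ 4 ∂μ ≤ 3 * (s.card : ℝ) ^ 2 * M := by
  have := hind.isProbabilityMeasure
  induction s using Finset.induction_on with
  | empty => simp
  | insert i s hi ih =>
    obtain ⟨ih4, ih2, ihb⟩ := ih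
    have hSm : Measurable (fun ω => ∑ i ∈ s, Y i ω) :=
      Finset.measurable_sum _ fun i _ => hmeas i
    have hIS : IndepFun (fun ω => ∑ i ∈ s, Y i ω) (Y i) μ := by
      have := hind.indepFun_finsetSum_of_notMem hmeas hi
      convert this using 1
      ext ω; simp
    set S : Ω → ℝ := fun ω => ∑ i ∈ s, Y i ω with hS
    have hM : 0 ≤ M := (integral_nonneg fun ω => by positivity).trans (hle i)
    have iS : ∀ k ≤ 4, Integrable (fun ω => S ω ^ k) μ := fun k hk =>
      integrable_pow_of_le hSm.aestronglyMeasurable hk ih4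
    have iY : ∀ k ≤ 4, Integrable (fun ω => Y i ω ^ k) μ := fun k hk =>
      integrable_pow_of_le (hmeas i).aestronglyMeasurable hk (hint i)
    have hI : ∀ a b : ℕ, IndepFun (fun ω => S ω ^ a) (fun ω => Y i ω ^ b) μ := fun a b =>
      hIS.comp (φ := fun x => x ^ a) (ψ := fun x => x ^ b) (by fun_prop) (by fun_prop)
    have iSY : ∀ a ≤ 4, ∀ b ≤ 4, Integrable (fun ω => S ω ^ a * Y i ω ^ b) μ :=
      fun a ha b hb => (hI a b).integrable_mul (iS a ha) (iY b hb)
    have eSY : ∀ a ≤ 4, ∀ b ≤ 4, ∫ ω, S ω ^ a * Y i ω ^ b ∂μ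
        = (∫ ω, S ω ^ a ∂μ) * ∫ ω, Y i ω ^ b ∂μ := fun a ha b hb =>
      (hI a b).integral_fun_mul_eq_mul_integral (iS a ha).1 (iY b hb).1
    have sq2 : ∫ ω, Y i ω ^ 2 ∂μ ≤ √M := by
      apply Real.le_sqrt_of_sq_le
      have := sq_integral_le_integral_sq (Y := fun ω => Y i ω ^ 2) (iY 2 (by norm_num))
        (by simpa [← pow_mul] using hint i)
      simp only [← pow_mul, Nat.reduceMul] at this
      exact this.trans (hle i)
    have sq0 : 0 ≤ ∫ ω, Y i ω ^ 2 ∂μ := integral_nonneg fun ω => by positivity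
    have sS0 : 0 ≤ ∫ ω, S ω ^ 2 ∂μ := integral_nonneg fun ω => by positivity
    have e4 : (fun ω => (∑ j ∈ insert i s, Y j ω) ^ 4) = fun ω =>
        S ω ^ 4 * Y i ω ^ 0 + 4 * (S ω ^ 3 * Y i ω ^ 1) + 6 * (S ω ^ 2 * Y i ω ^ 2)
        + 4 * (S ω ^ 1 * Y i ω ^ 3) + S ω ^ 0 * Y i ω ^ 4 := by
      ext ω; rw [Finset.sum_insert hi]; simp only [hS]; ring
    have e2 : (fun ω => (∑ j ∈ insert i s, Y j ω) ^ 2) = fun ω =>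
        S ω ^ 2 * Y i ω ^ 0 + 2 * (S ω ^ 1 * Y i ω ^ 1) + S ω ^ 0 * Y i ω ^ 2 := by
      ext ω; rw [Finset.sum_insert hi]; simp only [hS]; ring
    have zS : ∫ ω, S ω ∂μ = 0 := by
      rw [hS, integral_finsetSum _ fun j _ => ?_]
      · simp [hzero]
      · simpa using integrable_pow_of_le (hmeas j).aestronglyMeasurable
          (show 1 ≤ 4 by norm_num) (hint j)
    have n1 : (1:ℕ) ≤ 4 := by norm_num
    have n2 : (2:ℕ) ≤ 4 := by norm_num
    have n3 : (3:ℕ) ≤ 4 := by norm_num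
    have n0 : (0:ℕ) ≤ 4 := by norm_num
    have J1 := iSY 4 le_rfl 0 n0
    have J2 := (iSY 3 n3 1 n1).const_mul 4
    have J3 := (iSY 2 n2 2 n2).const_mul 6
    have J4 := (iSY 1 n1 3 n3).const_mul 4
    have J5 := iSY 0 n0 4 le_rfl
    have K1 := iSY 2 n2 0 n0
    have K2 := (iSY 1 n1 1 n1).const_mul 2
    have K3 := iSY 0 n0 2 n2
    have K12 : Integrable (fun ω => S ω ^ 2 * Y i ω ^ 0 + 2 * (S ω ^ 1 * Y i ω ^ 1)) μ := K1.add K2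
    have J12 : Integrable (fun ω => S ω ^ 4 * Y i ω ^ 0 + 4 * (S ω ^ 3 * Y i ω ^ 1)) μ :=
      J1.add J2
    have J123 : Integrable (fun ω => S ω ^ 4 * Y i ω ^ 0 + 4 * (S ω ^ 3 * Y i ω ^ 1)
        + 6 * (S ω ^ 2 * Y i ω ^ 2)) μ := J12.add J3
    have J1234 : Integrable (fun ω => S ω ^ 4 * Y i ω ^ 0 + 4 * (S ω ^ 3 * Y i ω ^ 1)
        + 6 * (S ω ^ 2 * Y i ω ^ 2) + 4 * (S ω ^ 1 * Y i ω ^ 3)) μ := J123.add J4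
    have hcard : ((insert i s).card : ℝ) = s.card + 1 := by
      rw [Finset.card_insert_of_notMem hi]; push_cast; ring
    refine ⟨?_, ?_, ?_⟩
    · rw [e4]
      exact J1234.add J5
    · rw [e2, integral_add K12 K3, integral_add K1 K2, integral_const_mul,
        eSY 2 n2 0 n0, eSY 1 n1 1 n1, eSY 0 n0 2 n2]
      simp only [pow_zero, pow_one, hzero, zS, integral_const, probReal_univ, smul_eq_mul]
      rw [hcard]
      nlinarith
    · rw [e4, integral_add J1234 J5, integral_add J123 J4, integral_add J12 J3, integral_add J1 J2,
        integral_const_mul, integral_const_mul, integral_const_mul,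
        eSY 4 le_rfl 0 n0, eSY 3 n3 1 n1, eSY 2 n2 2 n2, eSY 1 n1 3 n3, eSY 0 n0 4 le_rfl]
      simp only [pow_zero, pow_one, hzero, zS, integral_const, probReal_univ, smul_eq_mul]
      rw [hcard]
      -- With `k = s.card`, the odd cross terms vanish and the induction closes by `3k² + 6k + 1 ≤
      -- 3(k+1)²`; the second moment bound is carried along only to control the `6k` term.
      have h1 : (∫ ω, S ω ^ 2 ∂μ) * ∫ ω, Y i ω ^ 2 ∂μ ≤ s.card * √M * √M :=
        mul_le_mul ih2 sq2 sq0 (by positivity)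
      rw [mul_assoc, Real.mul_self_sqrt hM] at h1
      nlinarith [hle i]

/-- Fourth moment of the norm of an average of independent centred random vectors. -/
lemma fourth_moment_norm_average_le {d n : ℕ} (hn : 0 < n)
    {Y : Fin n → Ω → EuclideanSpace ℝ (Fin d)} {M : ℝ}
    (hind : iIndepFun Y μ) (hmeas : ∀ i, Measurable (Y i)) (hzero : ∀ i, ∫ ω, Y i ω ∂μ = 0)
    (hint : ∀ i, Integrable (fun ω => ‖Y i ω‖ ^ 4) μ) (hle : ∀ i, ∫ ω, ‖Y i ω‖ ^ 4 ∂μ ≤ M) :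
    Integrable (fun ω => ‖(1 / (n : ℝ)) • ∑ i, Y i ω‖ ^ 4) μ ∧
      ∫ ω, ‖(1 / (n : ℝ)) • ∑ i, Y i ω‖ ^ 4 ∂μ ≤ 3 * (d : ℝ) ^ 2 * M / (n : ℝ) ^ 2 := by
  have := hind.isProbabilityMeasure
  have hcm : ∀ k : Fin d, Measurable (fun v : EuclideanSpace ℝ (Fin d) => v k) := fun k => by
    fun_prop
  have hYk : ∀ k i, Measurable (fun ω => Y i ω k) := fun k i => (hcm k).comp (hmeas i)
  have habs : ∀ (v : EuclideanSpace ℝ (Fin d)) k, |v k| ≤ ‖v‖ := fun v k => by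
    simpa using PiLp.norm_apply_le v k
  have hpow : ∀ (v : EuclideanSpace ℝ (Fin d)) k, v k ^ 4 ≤ ‖v‖ ^ 4 := fun v k => by
    rw [← Even.pow_abs (by decide : Even 4) (v k)]
    exact pow_le_pow_left₀ (abs_nonneg _) (habs v k) 4
  have hik : ∀ k i, Integrable (fun ω => Y i ω k ^ 4) μ := fun k i => by
    refine (hint i).mono' ((hYk k i).pow_const 4).aestronglyMeasurable
      (Filter.Eventually.of_forall fun ω => ?_)
    rw [Real.norm_of_nonneg (by positivity)]
    exact hpow _ _
  have hYi : ∀ i, Integrable (Y i) μ := fun i => by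
    rw [← integrable_norm_iff (hmeas i).aestronglyMeasurable]
    simpa using integrable_pow_of_le (hmeas i).norm.aestronglyMeasurable
      (show 1 ≤ 4 by norm_num) (hint i)
  have key : ∀ k, _ := fun k => fourth_moment_sum_le (Y := fun i ω => Y i ω k) (M := M)
    (hind.comp (fun _ v => v k) fun _ => hcm k) (hYk k)
    (fun i => by
      have := (EuclideanSpace.proj k : EuclideanSpace ℝ (Fin d) →L[ℝ] ℝ).integral_comp_comm (hYi i)
      simpa [hzero i] using this)
    (hik k)
    (fun i => (integral_mono (hik k i) (hint i) fun ω => hpow _ _).trans (hle i)) Finset.univ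
  -- Passing to coordinates costs one factor `d` by Cauchy–Schwarz; summing over the coordinates
  -- costs the other.
  have hnorm : ∀ v : EuclideanSpace ℝ (Fin d), ‖v‖ ^ 4 ≤ d * ∑ k, v k ^ 4 := fun v => by
    have h1 : ‖v‖ ^ 4 = (∑ k, v k ^ 2) ^ 2 := by
      rw [← EuclideanSpace.real_norm_sq_eq]; ring
    rw [h1]
    have := sq_sum_le_card_mul_sum_sq (s := Finset.univ) (f := fun k => v k ^ 2)
    simpa [← pow_mul] using this
  have hSm : Measurable (fun ω => ∑ i, Y i ω) := Finset.measurable_sum _ fun i _ => hmeas i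
  have hdom : Integrable (fun ω => (d : ℝ) * ∑ k, (∑ i, Y i ω k) ^ 4) μ :=
    (integrable_finsetSum _ fun k _ => (key k).1).const_mul _
  have hbd : ∀ ω, ‖∑ i, Y i ω‖ ^ 4 ≤ (d : ℝ) * ∑ k, (∑ i, Y i ω k) ^ 4 := fun ω => by
    simpa using hnorm (∑ i, Y i ω)
  have hI : Integrable (fun ω => ‖∑ i, Y i ω‖ ^ 4) μ :=
    hdom.mono' (hSm.norm.pow_const 4).aestronglyMeasurable
      (Filter.Eventually.of_forall fun ω => by
        rw [Real.norm_of_nonneg (by positivity)]; exact hbd ω)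
  have e : ∀ ω, ‖(1 / (n : ℝ)) • ∑ i, Y i ω‖ ^ 4 = (1 / (n : ℝ)) ^ 4 * ‖∑ i, Y i ω‖ ^ 4 :=
    fun ω => by rw [norm_smul, mul_pow, Real.norm_of_nonneg (by positivity)]
  simp_rw [e]
  refine ⟨hI.const_mul _, ?_⟩
  rw [integral_const_mul]
  have h1 : ∫ ω, ‖∑ i, Y i ω‖ ^ 4 ∂μ ≤ d * ∑ _k : Fin d, 3 * (n : ℝ) ^ 2 * M := by
    refine (integral_mono hI hdom hbd).trans ?_
    rw [integral_const_mul, integral_finsetSum _ fun k _ => (key k).1]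
    gcongr with k
    simpa using (key k).2.2
  have hn' : (0 : ℝ) < n := by exact_mod_cast hn
  calc (1 / (n : ℝ)) ^ 4 * ∫ ω, ‖∑ i, Y i ω‖ ^ 4 ∂μ
      ≤ (1 / (n : ℝ)) ^ 4 * (d * ∑ _k : Fin d, 3 * (n : ℝ) ^ 2 * M) := by gcongr
    _ = 3 * (d : ℝ) ^ 2 * M / (n : ℝ) ^ 2 := by
      simp; field_simp

end Moments

/-! ### Convexity, Taylor expansion and localization of minimizers. -/

section Calculus

variable {E : Type*} [NormedAddCommGroup E] [NormedSpace ℝ E]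

/-- A differentiable convex function lies above its tangent planes. -/
lemma ConvexOn.add_fderiv_apply_sub_le {s : Set E} {φ : E → ℝ} {φ' : E →L[ℝ] ℝ} {x y : E}
    (hφ : ConvexOn ℝ s φ) (hx : x ∈ s) (hy : y ∈ s) (hd : HasFDerivAt φ φ' x) :
    φ x + φ' (y - x) ≤ φ y := by
  set γ : ℝ →ᵃ[ℝ] E := AffineMap.lineMap x y with hγ
  have hc : ConvexOn ℝ (γ ⁻¹' s) (φ ∘ γ) := hφ.comp_affineMap γ
  have hg : HasDerivAt γ (y - x) 0 := AffineMap.hasDerivAt_lineMap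
  have hd' : HasFDerivAt φ φ' (γ 0) := by simpa [hγ] using hd
  have h0 : HasDerivAt (φ ∘ γ) (φ' (y - x)) 0 := hd'.comp_hasDerivAt 0 hg
  have := hc.le_slope_of_hasDerivAt (x := 0) (y := 1) (by simpa [hγ] using hx)
    (by simpa [hγ] using hy) one_pos h0
  simp only [slope_def_field, Function.comp_apply, hγ, AffineMap.lineMap_apply_one,
    AffineMap.lineMap_apply_zero, sub_zero, div_one] at this
  linarith

variable {d : ℕ}

local notation "𝔼" => EuclideanSpace ℝ (Fin d)

lemma inner_gradient_eq_fderiv (φ : 𝔼 → ℝ) (θ v : 𝔼) :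
    inner ℝ v (gradient φ θ) = fderiv ℝ φ θ v := by
  rw [inner_gradient_right]; simp

/-- Second order expansion of a function whose Hessian is Lipschitz at the base point. -/
lemma norm_gradient_sub_le {φ : 𝔼 → ℝ} {θs θ : 𝔼} {ρ ℓ : ℝ}
    (hd : ∀ η ∈ Metric.ball θs ρ, DifferentiableAt ℝ (gradient φ) η)
    (hl : ∀ η ∈ Metric.ball θs ρ, ‖hessian φ η - hessian φ θs‖ ≤ ℓ * ‖η - θs‖)
    (hθ : θ ∈ Metric.ball θs ρ) :
    ‖gradient φ θ - gradient φ θs - hessian φ θs (θ - θs)‖ ≤ ℓ * ‖θ - θs‖ ^ 2 := by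
  rcases eq_or_ne θ θs with rfl | hne
  · simp
  have hpos : 0 < ‖θ - θs‖ := norm_pos_iff.2 (sub_ne_zero.2 hne)
  have hℓ : 0 ≤ ℓ := by
    have := (norm_nonneg _).trans (hl θ hθ)
    exact nonneg_of_mul_nonneg_left this hpos
  rw [mem_ball_iff_norm] at hθ
  have hsub : ∀ η ∈ Metric.closedBall θs ‖θ - θs‖, η ∈ Metric.ball θs ρ := fun η hη => by
    rw [mem_closedBall_iff_norm] at hη
    rw [mem_ball_iff_norm]
    exact hη.trans_lt hθ
  -- Mean value inequality on the closed ball through `θ`, where the Hessian differs from `hessian φ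
  -- θs` by at most `ℓ * ‖θ - θs‖`; the factor 1/2 of the exact Taylor bound is not needed.
  have := Convex.norm_image_sub_le_of_norm_fderiv_le' (𝕜 := ℝ) (f := gradient φ)
    (φ := hessian φ θs) (C := ℓ * ‖θ - θs‖) (s := Metric.closedBall θs ‖θ - θs‖)
    (x := θs) (y := θ) (fun η hη => hd η (hsub η hη))
    (fun η hη => (hl η (hsub η hη)).trans
      (mul_le_mul_of_nonneg_left (mem_closedBall_iff_norm.1 hη) hℓ))
    (convex_closedBall _ _) (Metric.mem_closedBall_self hpos.le)
    (mem_closedBall_iff_norm.2 le_rfl)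
  rwa [mul_assoc, ← pow_two] at this

/-- Localization of the minimizer of a convex function that is strongly convex near a point at which
its gradient is small. -/
lemma norm_sub_le_of_isMinOn {Θ : Set 𝔼} {φ : 𝔼 → ℝ} {θs θh : 𝔼} {ρ ℓ lam δ : ℝ}
    {S : 𝔼 →L[ℝ] 𝔼} (hc : ConvexOn ℝ Θ φ) (hball : Metric.ball θs ρ ⊆ Θ)
    (hd1 : ∀ η ∈ Metric.ball θs ρ, DifferentiableAt ℝ φ η)
    (hd : ∀ η ∈ Metric.ball θs ρ, DifferentiableAt ℝ (gradient φ) η)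
    (hl : ∀ η ∈ Metric.ball θs ρ, ‖hessian φ η - hessian φ θs‖ ≤ ℓ * ‖η - θs‖)
    (hlam : 0 < lam) (hS : ∀ v, lam * ‖v‖ ^ 2 ≤ inner ℝ v (S v))
    (hA : ‖hessian φ θs - S‖ ≤ lam / 4) (hδ : 0 < δ) (hδρ : δ < ρ) (hℓδ : ℓ * δ ≤ lam / 4)
    (hg : ‖gradient φ θs‖ < lam / 2 * δ) (hθΘ : θh ∈ Θ) (hmin : IsMinOn φ Θ θh) :
    ‖θh - θs‖ ≤ 2 / lam * ‖gradient φ θs‖ ∧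
      ‖gradient φ θs + hessian φ θs (θh - θs)‖ ≤ ℓ * ‖θh - θs‖ ^ 2 := by
  -- Of the curvature `lam`, one quarter is lost to the Hessian error and one quarter to the Taylor
  -- remainder. The remaining `lam / 2` must be balanced by the gradient at `θs` if `φ` does not
  -- increase radially at `θ`.
  have key : ∀ θ ∈ Metric.ball θs ρ, ‖θ - θs‖ ≤ δ → fderiv ℝ φ θ (θ - θs) ≤ 0 →
      lam / 2 * ‖θ - θs‖ ≤ ‖gradient φ θs‖ := by
    intro θ hθ hle hneg
    have hr := norm_gradient_sub_le hd hl hθ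
    set v := θ - θs with hv
    set r := gradient φ θ - gradient φ θs - hessian φ θs v with hr'
    rcases eq_or_ne v 0 with h0 | h0
    · simp [h0]
    have hvp : 0 < ‖v‖ := norm_pos_iff.2 h0
    have h1 : inner ℝ v (gradient φ θ) ≤ 0 := by rw [inner_gradient_eq_fderiv]; exact hneg
    have h2 : gradient φ θ = gradient φ θs + S v + (hessian φ θs - S) v + r := by
      simp [hr']
    rw [h2, inner_add_right, inner_add_right, inner_add_right] at h1
    have h3 := abs_le.1 (abs_real_inner_le_norm v (gradient φ θs))
    have h4 := abs_le.1 (abs_real_inner_le_norm v ((hessian φ θs - S) v))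
    have h5 := abs_le.1 (abs_real_inner_le_norm v r)
    have h6 : ‖(hessian φ θs - S) v‖ ≤ lam / 4 * ‖v‖ :=
      ((hessian φ θs - S).le_opNorm v).trans (by gcongr)
    have hr2 : ‖r‖ ≤ lam / 4 * ‖v‖ := by
      have hℓ : 0 ≤ ℓ := by
        have := (norm_nonneg _).trans hr
        exact nonneg_of_mul_nonneg_left this (by positivity)
      refine hr.trans ?_
      have : ℓ * ‖v‖ ≤ lam / 4 := (mul_le_mul_of_nonneg_left hle hℓ).trans hℓδ
      nlinarith
    have h7 := hS v
    have h8 : ‖v‖ * ‖(hessian φ θs - S) v‖ ≤ ‖v‖ * (lam / 4 * ‖v‖) := by gcongr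
    have h9 : ‖v‖ * ‖r‖ ≤ ‖v‖ * (lam / 4 * ‖v‖) := by gcongr
    have : (lam / 2 * ‖v‖) * ‖v‖ ≤ ‖gradient φ θs‖ * ‖v‖ := by nlinarith
    exact le_of_mul_le_mul_right this hvp
  -- If `θh` were farther away, the point at distance `δ` on the segment to `θh` would have
  -- nonpositive radial derivative by convexity, and `key` there would contradict `hg`.
  have hloc : ‖θh - θs‖ ≤ δ := by
    by_contra! hgt
    have hpos : 0 < ‖θh - θs‖ := hδ.trans hgt
    set t := δ / ‖θh - θs‖ with ht
    have ht0 : 0 < t := by positivity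
    have ht1 : t < 1 := (div_lt_one hpos).2 hgt
    set θ := θs + t • (θh - θs) with hθ
    have e1 : θ - θs = t • (θh - θs) := by simp [hθ]
    have e2 : ‖θ - θs‖ = δ := by
      rw [e1, norm_smul, Real.norm_of_nonneg ht0.le, ht]; field_simp
    have hb : θ ∈ Metric.ball θs ρ := by rw [mem_ball_iff_norm, e2]; exact hδρ
    have e3 : θh - θ = (1 - t) • (θh - θs) := by simp only [hθ, sub_smul, one_smul]; abel
    have h1 := hc.add_fderiv_apply_sub_le (hball hb) hθΘ (hd1 θ hb).hasFDerivAt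
    have h2 : φ θh ≤ φ θ := hmin (hball hb)
    have h3 : fderiv ℝ φ θ (θ - θs) ≤ 0 := by
      have : fderiv ℝ φ θ (θh - θ) ≤ 0 := by linarith
      rw [e3, map_smul, smul_eq_mul] at this
      rw [e1, map_smul, smul_eq_mul]
      have : fderiv ℝ φ θ (θh - θs) ≤ 0 := nonpos_of_mul_nonpos_right this (by linarith)
      exact mul_nonpos_of_nonneg_of_nonpos ht0.le this
    have := key θ hb e2.le h3
    rw [e2] at this
    linarith
  have hb : θh ∈ Metric.ball θs ρ := by rw [mem_ball_iff_norm]; exact hloc.trans_lt hδρ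
  have hz : fderiv ℝ φ θh = 0 :=
    (hmin.isLocalMin (Filter.mem_of_superset (Metric.isOpen_ball.mem_nhds hb) hball)).fderiv_eq_zero
  have hgz : gradient φ θh = 0 := by simp [gradient, hz]
  refine ⟨?_, ?_⟩
  · have := key θh hb hloc (by simp [hz])
    rw [div_mul_eq_mul_div, le_div_iff₀ hlam]
    linarith
  · have := norm_gradient_sub_le hd hl hb
    rw [hgz, zero_sub, ← neg_add', norm_neg] at this
    exact this

lemma hasGradientAt_empRisk {𝒳 : Type*} {f : 𝔼 → 𝒳 → ℝ} {n : ℕ} (s : Fin n → 𝒳) {θ : 𝔼}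
    (hd : ∀ x, DifferentiableAt ℝ (fun η => f η x) θ) :
    HasGradientAt (empRisk f s) ((1 / (n : ℝ)) • ∑ j, gradient (fun η => f η (s j)) θ) θ := by
  rw [hasGradientAt_iff_hasFDerivAt]
  have h : HasFDerivAt (empRisk f s)
      ((1 / (n : ℝ)) • ∑ j, fderiv ℝ (fun η => f η (s j)) θ) θ :=
    (HasFDerivAt.fun_sum fun j _ => (hd (s j)).hasFDerivAt).const_mul _
  have e : InnerProductSpace.toDual ℝ 𝔼
      ((1 / (n : ℝ)) • ∑ j, gradient (fun η => f η (s j)) θ)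
      = (1 / (n : ℝ)) • ∑ j, fderiv ℝ (fun η => f η (s j)) θ := by
    simp only [map_smulₛₗ, map_sum, toDual_gradient, RCLike.conj_to_real]
  rw [e]
  exact h

lemma hasFDerivAt_gradient_empRisk {𝒳 : Type*} {f : 𝔼 → 𝒳 → ℝ} {n : ℕ} (s : Fin n → 𝒳) {θs θ : 𝔼}
    {ρ : ℝ} (hd : ∀ x, ∀ θ ∈ Metric.ball θs ρ, DifferentiableAt ℝ (fun η => f η x) θ)
    (hd2 : ∀ x, ∀ θ ∈ Metric.ball θs ρ, DifferentiableAt ℝ (gradient (fun η => f η x)) θ)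
    (hθ : θ ∈ Metric.ball θs ρ) :
    HasFDerivAt (gradient (empRisk f s))
      ((1 / (n : ℝ)) • ∑ j, hessian (fun η => f η (s j)) θ) θ := by
  have h : HasFDerivAt (fun η => (1 / (n : ℝ)) • ∑ j, gradient (fun η => f η (s j)) η)
      ((1 / (n : ℝ)) • ∑ j, hessian (fun η => f η (s j)) θ) θ :=
    (HasFDerivAt.fun_sum fun j _ => (hd2 (s j) θ hθ).hasFDerivAt).fun_const_smul _
  refine h.congr_of_eventuallyEq ?_
  filter_upwards [Metric.isOpen_ball.mem_nhds hθ] with η hη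
  exact (hasGradientAt_empRisk s fun x => hd x η hη).gradient

lemma convexOn_empRisk {𝒳 : Type*} {f : 𝔼 → 𝒳 → ℝ} {Θ : Set 𝔼} {n : ℕ} (s : Fin n → 𝒳)
    (hΘ : Convex ℝ Θ) (hc : ∀ x, ConvexOn ℝ Θ (fun θ => f θ x)) :
    ConvexOn ℝ Θ (empRisk f s) := by
  have h : ConvexOn ℝ Θ (fun θ => ∑ j, f θ (s j)) := by
    refine ⟨hΘ, fun x hx y hy a b ha hb hab => ?_⟩
    simp only [smul_eq_mul, Finset.mul_sum, ← Finset.sum_add_distrib]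
    exact Finset.sum_le_sum fun j _ => (hc (s j)).2 hx hy ha hb hab
  exact h.smul (c := 1 / (n : ℝ)) (by positivity)

end Calculus

/-! ### Measurability of derivatives and differentiation of the population risk. -/

section DifferentiationUnderIntegral

variable {d : ℕ} {𝒳 : Type*} [MeasurableSpace 𝒳]

local notation "𝔼" => EuclideanSpace ℝ (Fin d)

/-- The derivative is a pointwise limit of the difference quotients `n (F(θ + v/n) - F(θ))`.
Measurability is available only near `θ`, so the sequence starts at an index `N` beyond which `θ +
v/n` lies in `s`. -/
lemma measurable_hasFDerivAt_apply {W : Type*} [NormedAddCommGroup W] [NormedSpace ℝ W]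
    [MeasurableSpace W] [BorelSpace W] [SecondCountableTopology W]
    {F : 𝔼 → 𝒳 → W} {F' : 𝒳 → 𝔼 →L[ℝ] W} {s : Set 𝔼} {θ : 𝔼}
    (hs : s ∈ nhds θ) (hF : ∀ η ∈ s, Measurable (F η))
    (hd : ∀ x, HasFDerivAt (fun η => F η x) (F' x) θ) (v : 𝔼) :
    Measurable (fun x => F' x v) := by
  have hc : Filter.Tendsto (fun n : ℕ => θ + ((n : ℝ))⁻¹ • v) Filter.atTop (nhds θ) := by
    have : Filter.Tendsto (fun n : ℕ => ((n : ℝ))⁻¹ • v) Filter.atTop (nhds ((0 : ℝ) • v)) :=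
      tendsto_inv_atTop_nhds_zero_nat.smul_const v
    simpa using this.const_add θ
  obtain ⟨N, hN⟩ := Filter.eventually_atTop.1 (hc.eventually hs)
  refine measurable_of_tendsto_metrizable
    (f := fun (n : ℕ) x => ((n + N : ℕ) : ℝ) • (F (θ + (((n + N : ℕ) : ℝ))⁻¹ • v) x - F θ x)) ?_ ?_
  · intro n
    exact (((hF _ (hN _ (Nat.le_add_left _ _))).sub (hF θ (mem_of_mem_nhds hs))).const_smul _)
  · rw [tendsto_pi_nhds]
    intro x
    have h := (hd x).lim v (c := fun n : ℕ => ((n + N : ℕ) : ℝ)) (l := Filter.atTop) (by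
      simp only [Real.norm_natCast]
      exact (tendsto_natCast_atTop_atTop).comp (Filter.tendsto_add_atTop_nat N))
    exact h

/-- An operator on `ℝᵈ` is a finite sum of rank-one operators built from its values on the basis.
This makes Hessians strongly measurable in operator norm, as their Bochner integrals require. -/
lemma stronglyMeasurable_clm {W : Type*} [NormedAddCommGroup W] [NormedSpace ℝ W]
    {A : 𝒳 → 𝔼 →L[ℝ] W} (h : ∀ v, StronglyMeasurable (fun x => A x v)) : StronglyMeasurable A := by
  have e : A = fun x => ∑ i : Fin d,
      ContinuousLinearMap.smulRightL ℝ 𝔼 W (EuclideanSpace.proj i)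
        (A x (EuclideanSpace.single i 1)) := by
    ext x v
    have hv : v = ∑ i, v i • EuclideanSpace.single i (1 : ℝ) := by
      ext k; simp [Pi.single_apply]
    conv_lhs => rw [hv]
    simp [map_sum]
  rw [e]
  refine Finset.stronglyMeasurable_fun_sum _ fun i _ => ?_
  exact (ContinuousLinearMap.continuous _).comp_stronglyMeasurable (h _)

lemma measurable_gradient {f : 𝔼 → 𝒳 → ℝ} {s : Set 𝔼} {θ : 𝔼} (hs : s ∈ nhds θ)
    (hf : ∀ η ∈ s, Measurable (f η)) (hd : ∀ x, DifferentiableAt ℝ (fun η => f η x) θ) :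
    Measurable (fun x => gradient (fun η => f η x) θ) := by
  have h : ∀ i, Measurable (fun x => (gradient (fun η => f η x) θ) i) := fun i => by
    have := measurable_hasFDerivAt_apply hs hf (fun x => (hd x).hasFDerivAt)
      (EuclideanSpace.single i 1)
    convert this using 2 with x
    rw [← inner_gradient_eq_fderiv, EuclideanSpace.inner_single_left]
    simp
  exact (MeasurableEquiv.toLp 2 (Fin d → ℝ)).measurable.comp (measurable_pi_lambda _ h)

variable {Θ : Set (EuclideanSpace ℝ (Fin d))} {f : EuclideanSpace ℝ (Fin d) → 𝒳 → ℝ}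
  {P : Measure 𝒳} {θs : EuclideanSpace ℝ (Fin d)} {R ρ lam G H L : ℝ}

namespace SmoothnessAssumption

lemma measurable_gradient (hS : SmoothnessAssumption Θ f P θs ρ G H L)
    (hm : ∀ θ ∈ Θ, Measurable (f θ)) {θ : 𝔼} (hθ : θ ∈ Metric.ball θs ρ) :
    Measurable (fun x => gradient (fun η => f η x) θ) :=
  _root_.measurable_gradient (Metric.isOpen_ball.mem_nhds hθ)
    (fun η hη => hm η (hS.ball_subset hη)) fun x => hS.differentiableAt x θ hθ

lemma measurable_hessian_apply (hS : SmoothnessAssumption Θ f P θs ρ G H L)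
    (hm : ∀ θ ∈ Θ, Measurable (f θ)) {θ : 𝔼} (hθ : θ ∈ Metric.ball θs ρ) (v : 𝔼) :
    Measurable (fun x => hessian (fun η => f η x) θ v) :=
  measurable_hasFDerivAt_apply (F := fun η x => gradient (fun η => f η x) η)
    (Metric.isOpen_ball.mem_nhds hθ)
    (fun _ hη => hS.measurable_gradient hm hη)
    (fun x => (hS.differentiableAt_gradient x θ hθ).hasFDerivAt) v

lemma stronglyMeasurable_hessian (hS : SmoothnessAssumption Θ f P θs ρ G H L)
    (hm : ∀ θ ∈ Θ, Measurable (f θ)) {θ : 𝔼} (hθ : θ ∈ Metric.ball θs ρ) :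
    StronglyMeasurable (fun x => hessian (fun η => f η x) θ) :=
  stronglyMeasurable_clm fun v => (hS.measurable_hessian_apply hm hθ v).stronglyMeasurable

lemma mem_ball (hS : SmoothnessAssumption Θ f P θs ρ G H L) : θs ∈ Metric.ball θs ρ :=
  Metric.mem_ball_self hS.rho_pos

lemma integrable_gradient [IsProbabilityMeasure P] (hS : SmoothnessAssumption Θ f P θs ρ G H L)
    (hm : ∀ θ ∈ Θ, Measurable (f θ)) {θ : 𝔼} (hθ : θ ∈ Metric.ball θs ρ) :
    Integrable (fun x => gradient (fun η => f η x) θ) P := by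
  have h := (hS.measurable_gradient hm hθ).aestronglyMeasurable (μ := P)
  rw [← integrable_norm_iff h]
  simpa using integrable_pow_of_le h.norm (show 1 ≤ 8 by norm_num) (hS.gradient_moment θ hθ).1

lemma integrable_hessian [IsProbabilityMeasure P] (hS : SmoothnessAssumption Θ f P θs ρ G H L)
    (hm : ∀ θ ∈ Θ, Measurable (f θ)) {θ : 𝔼} (hθ : θ ∈ Metric.ball θs ρ) :
    Integrable (fun x => hessian (fun η => f η x) θ) P := by
  have h : AEStronglyMeasurable
      (fun x => hessian (fun η => f η x) θ - hessian (popRisk f P) θ) P :=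
    ((hS.stronglyMeasurable_hessian hm hθ).sub stronglyMeasurable_const).aestronglyMeasurable
  have h1 : Integrable (fun x => hessian (fun η => f η x) θ - hessian (popRisk f P) θ) P := by
    refine (integrable_norm_iff h).1 ?_
    simpa using integrable_pow_of_le h.norm (show 1 ≤ 8 by norm_num) (hS.hessian_moment θ hθ).1
  refine (h1.add (integrable_const (hessian (popRisk f P) θ))).congr
    (Filter.Eventually.of_forall fun x => ?_)
  simp

/-- The Hessians and the gradients of the losses are dominated on the ball. -/
lemma exists_integrable_bound [IsProbabilityMeasure P]
    (hS : SmoothnessAssumption Θ f P θs ρ G H L) (hm : ∀ θ ∈ Θ, Measurable (f θ)) :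
    ∃ b : 𝒳 → ℝ, Integrable b P ∧ ∀ x, ∀ θ ∈ Metric.ball θs ρ,
      ‖hessian (fun η => f η x) θ‖ ≤ b x ∧ ‖gradient (fun η => f η x) θ‖ ≤ b x := by
  obtain ⟨Lip, hLm, hLip, ⟨hL8, -⟩, -⟩ := hS.hessian_lipschitz
  have hLi : Integrable Lip P := by
    simpa using integrable_pow_of_le hLm.aestronglyMeasurable (show 1 ≤ 8 by norm_num) hL8
  have hρ := hS.rho_pos
  set h2 : 𝒳 → ℝ := fun x => ‖hessian (fun η => f η x) θs‖ + |Lip x| * ρ with hh2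
  have ih2 : Integrable h2 P := (hS.integrable_hessian hm hS.mem_ball).norm.add (hLi.abs.mul_const _)
  have b2 : ∀ x, ∀ θ ∈ Metric.ball θs ρ, ‖hessian (fun η => f η x) θ‖ ≤ h2 x := by
    intro x θ hθ
    have h := hLip x θs hS.mem_ball θ hθ
    have h' : Lip x * ‖θ - θs‖ ≤ |Lip x| * ρ :=
      mul_le_mul (le_abs_self _) (mem_ball_iff_norm.1 hθ).le (norm_nonneg _) (abs_nonneg _)
    have := norm_le_norm_add_norm_sub' (hessian (fun η => f η x) θ) (hessian (fun η => f η x) θs)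
    simp only [hh2]
    linarith
  have h2n : ∀ x, 0 ≤ h2 x := fun x => by positivity
  -- The mean value inequality bounds the gradient by its value at `θs` plus `ρ * h2 x`; the extra
  -- `h2 x` lets the same function dominate the Hessian.
  refine ⟨fun x => ‖gradient (fun η => f η x) θs‖ + (ρ + 1) * h2 x,
    (hS.integrable_gradient hm hS.mem_ball).norm.add (ih2.const_mul _), fun x θ hθ => ⟨?_, ?_⟩⟩
  · have := b2 x θ hθ
    have := norm_nonneg (gradient (fun η => f η x) θs)
    nlinarith [h2n x]
  · have h := (convex_ball θs ρ).norm_image_sub_le_of_norm_fderiv_le (𝕜 := ℝ)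
      (hS.differentiableAt_gradient x) (b2 x) hS.mem_ball hθ
    have h' : h2 x * ‖θ - θs‖ ≤ h2 x * ρ :=
      mul_le_mul_of_nonneg_left (mem_ball_iff_norm.1 hθ).le (h2n x)
    have := norm_le_norm_add_norm_sub' (gradient (fun η => f η x) θ) (gradient (fun η => f η x) θs)
    nlinarith [h2n x]

/-- Dominated differentiation. At `θs`, where the population gradient vanishes, this says that the
score is centred. -/
lemma gradient_popRisk [IsProbabilityMeasure P] (hP : ParameterAssumption Θ f P θs R)
    (hS : SmoothnessAssumption Θ f P θs ρ G H L) (hm : ∀ θ ∈ Θ, Measurable (f θ))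
    {θ : 𝔼} (hθ : θ ∈ Metric.ball θs ρ) :
    gradient (popRisk f P) θ = ∫ x, gradient (fun η => f η x) θ ∂P := by
  obtain ⟨b, hb, hbd⟩ := hS.exists_integrable_bound hm
  have hmem := Metric.isOpen_ball.mem_nhds hθ
  have hfm : StronglyMeasurable (fun x => fderiv ℝ (fun η => f η x) θ) :=
    stronglyMeasurable_clm fun v => (measurable_hasFDerivAt_apply hmem
      (fun η hη => hm η (hS.ball_subset hη))
      (fun x => (hS.differentiableAt x θ hθ).hasFDerivAt) v).stronglyMeasurable
  have hnorm : ∀ x η, ‖fderiv ℝ (fun η => f η x) η‖ = ‖gradient (fun η => f η x) η‖ :=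
    fun x η => by simp [gradient]
  have key : HasFDerivAt (popRisk f P) (∫ x, fderiv ℝ (fun η => f η x) θ ∂P) θ :=
    hasFDerivAt_integral_of_dominated_of_fderiv_le (F := f) (bound := b)
      (F' := fun η x => fderiv ℝ (fun η => f η x) η) hmem
      (Filter.mem_of_superset hmem fun η hη =>
        (hm η (hS.ball_subset hη)).aestronglyMeasurable)
      (hP.integrable_loss θ (hS.ball_subset hθ)) hfm.aestronglyMeasurable
      (Filter.Eventually.of_forall fun x η hη => by rw [hnorm]; exact (hbd x η hη).2) hb
      (Filter.Eventually.of_forall fun x η hη => (hS.differentiableAt x η hη).hasFDerivAt)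
  have hi : Integrable (fun x => fderiv ℝ (fun η => f η x) θ) P :=
    hb.mono' hfm.aestronglyMeasurable
      (Filter.Eventually.of_forall fun x => by rw [hnorm]; exact (hbd x θ hθ).2)
  refine ext_inner_left ℝ fun v => ?_
  rw [inner_gradient_eq_fderiv, key.fderiv, ContinuousLinearMap.integral_apply hi,
    ← integral_inner (hS.integrable_gradient hm hθ)]
  simp_rw [inner_gradient_eq_fderiv]

/-- A second differentiation under the integral, which makes the Hessian deviations at `θs` centred.
-/
lemma hessian_popRisk [IsProbabilityMeasure P] (hP : ParameterAssumption Θ f P θs R)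
    (hS : SmoothnessAssumption Θ f P θs ρ G H L) (hm : ∀ θ ∈ Θ, Measurable (f θ)) :
    hessian (popRisk f P) θs = ∫ x, hessian (fun η => f η x) θs ∂P := by
  obtain ⟨b, hb, hbd⟩ := hS.exists_integrable_bound hm
  have hmem := Metric.isOpen_ball.mem_nhds hS.mem_ball
  have key : HasFDerivAt (fun η => ∫ x, gradient (fun η => f η x) η ∂P)
      (∫ x, hessian (fun η => f η x) θs ∂P) θs :=
    hasFDerivAt_integral_of_dominated_of_fderiv_le
      (F := fun η x => gradient (fun η => f η x) η) (bound := b)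
      (F' := fun η x => hessian (fun η => f η x) η) hmem
      (Filter.mem_of_superset hmem fun η hη =>
        (hS.measurable_gradient hm hη).aestronglyMeasurable)
      (hS.integrable_gradient hm hS.mem_ball)
      (hS.stronglyMeasurable_hessian hm hS.mem_ball).aestronglyMeasurable
      (Filter.Eventually.of_forall fun x η hη => (hbd x η hη).1) hb
      (Filter.Eventually.of_forall fun x η hη => (hS.differentiableAt_gradient x η hη).hasFDerivAt)
  refine (key.congr_of_eventuallyEq ?_).fderiv
  filter_upwards [hmem] with η hη
  exact hS.gradient_popRisk hP hm hη

end SmoothnessAssumption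

lemma ParameterAssumption.gradient_popRisk_eq_zero (hP : ParameterAssumption Θ f P θs R) :
    gradient (popRisk f P) θs = 0 := by
  have hmin : IsLocalMin (popRisk f P) θs := by
    filter_upwards [mem_interior_iff_mem_nhds.1 hP.mem_interior] with θ hθ
    rcases eq_or_ne θ θs with rfl | hne
    · exact le_rfl
    · exact (hP.isUniqueMin θ hθ hne).le
  simp [gradient, hmin.fderiv_eq_zero]

end DifferentiationUnderIntegral

/-! ### Comparison of the Fisher information with the population Hessian. -/

section Fisher

variable {d : ℕ} {𝒳 : Type*} [MeasurableSpace 𝒳]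

local notation "𝔼" => EuclideanSpace ℝ (Fin d)

-- Second order Taylor limit by one use of L'Hôpital's rule; the derivative `g'` need only be
-- differentiable at 0 itself.
open Filter Topology in
lemma tendsto_div_sq_of_hasDerivAt {g g' : ℝ → ℝ} {c : ℝ}
    (hg : ∀ᶠ t in 𝓝 0, HasDerivAt g (g' t) t) (h0 : g 0 = 0) (h0' : g' 0 = 0)
    (hg' : HasDerivAt g' c 0) : Tendsto (fun t => g t / t ^ 2) (𝓝[>] 0) (𝓝 (c / 2)) := by
  refine HasDerivAt.lhopital_zero_nhdsGT (f' := g') (g' := fun t => 2 * t)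
    (hg.filter_mono nhdsWithin_le_nhds) (Eventually.of_forall fun t => ?_) ?_ ?_ ?_ ?_
  · simpa using hasDerivAt_pow 2 t
  · filter_upwards [self_mem_nhdsWithin] with t ht
    have : 0 < t := ht
    positivity
  · have := hg.self_of_nhds.continuousAt.tendsto
    rw [h0] at this
    exact this.mono_left nhdsWithin_le_nhds
  · have : Tendsto (fun t : ℝ => t ^ 2) (𝓝 0) (𝓝 (0 ^ 2)) := (continuous_pow 2).tendsto 0
    simpa using this.mono_left nhdsWithin_le_nhds
  · have h := hg'.tendsto_slope_zero_right
    simp only [zero_add, h0', sub_zero, smul_eq_mul] at h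
    refine (h.div_const 2).congr fun t => ?_
    ring

variable {Θ : Set (EuclideanSpace ℝ (Fin d))} {f : EuclideanSpace ℝ (Fin d) → 𝒳 → ℝ}
  {P ν : Measure 𝒳} {p : EuclideanSpace ℝ (Fin d) → 𝒳 → ℝ}
  {θs : EuclideanSpace ℝ (Fin d)} {R ρ lam G H L : ℝ}

/-- The likelihood ratios integrate to one. -/
lemma integral_exp_neg_loss_sub (hfam : IsParametricFamily Θ ν p)
    (hf : ∀ θ ∈ Θ, ∀ x, f θ x = negLogLikelihood p θ x) (hPm : P = modelMeasure ν p θs)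
    (hθs : θs ∈ Θ) {θ : 𝔼} (hθ : θ ∈ Θ) :
    ∫ x, Real.exp (-(f θ x - f θs x)) ∂P = 1 := by
  have e : ∀ x, Real.exp (-(f θ x - f θs x)) = p θ x / p θs x := fun x => by
    rw [hf θ hθ, hf θs hθs, negLogLikelihood, negLogLikelihood]
    rw [show -(-Real.log (p θ x) - -Real.log (p θs x)) = Real.log (p θ x) - Real.log (p θs x) by
      ring, Real.exp_sub, Real.exp_log (hfam.pos θ hθ x), Real.exp_log (hfam.pos θs hθs x)]
  simp_rw [e]
  have m1 := hfam.measurable θ hθ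
  have m2 := hfam.measurable θs hθs
  have hmd : Measurable (fun x => ENNReal.ofReal (p θ x / p θs x)) := (m1.div m2).ennreal_ofReal
  rw [integral_eq_lintegral_of_nonneg_ae
    (Filter.Eventually.of_forall fun x => (div_pos (hfam.pos θ hθ x) (hfam.pos θs hθs x)).le)
    (m1.div m2).aestronglyMeasurable, hPm, modelMeasure,
    lintegral_withDensity_eq_lintegral_mul _ m2.ennreal_ofReal hmd]
  have : ∀ x, ((fun x => ENNReal.ofReal (p θs x)) * fun x => ENNReal.ofReal (p θ x / p θs x)) x
      = ENNReal.ofReal (p θ x) := fun x => by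
    have := hfam.pos θs hθs x
    rw [Pi.mul_apply, ← ENNReal.ofReal_mul this.le]
    congr 1; field_simp
  simp_rw [this]
  have h1 := (hfam.isProbabilityMeasure θ hθ).measure_univ
  rw [modelMeasure, withDensity_apply _ MeasurableSet.univ, Measure.restrict_univ] at h1
  rw [h1]; simp

lemma SmoothnessAssumption.integrable_inner_gradient_sq [IsProbabilityMeasure P]
    (hS : SmoothnessAssumption Θ f P θs ρ G H L) (hm : ∀ θ ∈ Θ, Measurable (f θ)) (v : 𝔼) :
    Integrable (fun x => (inner ℝ v (gradient (fun η => f η x) θs) : ℝ) ^ 2) P := by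
  have h := hS.measurable_gradient hm hS.mem_ball
  have h2 := integrable_pow_of_le h.norm.aestronglyMeasurable (show 2 ≤ 8 by norm_num)
    (hS.gradient_moment θs hS.mem_ball).1
  refine (h2.const_mul (‖v‖ ^ 2)).mono' ((h.const_inner).pow_const 2).aestronglyMeasurable
    (Filter.Eventually.of_forall fun x => ?_)
  rw [Real.norm_of_nonneg (by positivity), ← mul_pow, ← sq_abs]
  exact pow_le_pow_left₀ (abs_nonneg _) (abs_real_inner_le_norm _ _) 2

lemma hasDerivAt_line {φ : 𝔼 → ℝ} {v : 𝔼} {t : ℝ}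
    (h : DifferentiableAt ℝ φ (θs + t • v)) :
    HasDerivAt (fun s : ℝ => φ (θs + s • v)) (inner ℝ v (gradient φ (θs + t • v))) t := by
  have hl : HasDerivAt (fun s : ℝ => θs + s • v) v t := by
    simpa using ((hasDerivAt_id t).smul_const v).const_add θs
  rw [inner_gradient_eq_fderiv]
  exact HasFDerivAt.comp_hasDerivAt (l := φ) t h.hasFDerivAt hl

lemma hasDerivAt_inner_gradient_line {φ : 𝔼 → ℝ} {v : 𝔼}
    (h : DifferentiableAt ℝ (gradient φ) θs) :
    HasDerivAt (fun s : ℝ => (inner ℝ v (gradient φ (θs + s • v)) : ℝ))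
      (inner ℝ v (hessian φ θs v)) 0 := by
  have hl : HasDerivAt (fun s : ℝ => θs + s • v) v 0 := by
    simpa using ((hasDerivAt_id (0 : ℝ)).smul_const v).const_add θs
  have h' : HasFDerivAt (gradient φ) (hessian φ θs) (θs + (0 : ℝ) • v) := by
    rw [zero_smul, add_zero]; exact h.hasFDerivAt
  have hc : HasDerivAt (fun s : ℝ => gradient φ (θs + s • v)) (hessian φ θs v) 0 :=
    HasFDerivAt.comp_hasDerivAt (l := gradient φ) 0 h' hl
  simpa using (hasDerivAt_const (0 : ℝ) v).inner ℝ hc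

open Filter Topology in
/-- The Fisher information is bounded by the expected Hessian, as a quadratic form. -/
lemma integral_inner_gradient_sq_le [IsProbabilityMeasure P] (hP : ParameterAssumption Θ f P θs R)
    (hC : LocalStrongConvexity f P θs ρ lam) (hS : SmoothnessAssumption Θ f P θs ρ G H L)
    (hm : ∀ θ ∈ Θ, Measurable (f θ))
    (hone : ∀ θ ∈ Θ, ∫ x, Real.exp (-(f θ x - f θs x)) ∂P = 1) (v : 𝔼) :
    ∫ x, (inner ℝ v (gradient (fun η => f η x) θs) : ℝ) ^ 2 ∂P
      ≤ inner ℝ v (hessian (popRisk f P) θs v) := by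
  have hline : Tendsto (fun t : ℝ => θs + t • v) (𝓝 0) (𝓝 θs) := by
    have : Continuous (fun t : ℝ => θs + t • v) := by fun_prop
    simpa using this.tendsto 0
  have hev : ∀ᶠ t : ℝ in 𝓝 0, θs + t • v ∈ Metric.ball θs ρ :=
    hline.eventually (Metric.isOpen_ball.mem_nhds hS.mem_ball)
  have hθs : θs ∈ Θ := hS.ball_subset hS.mem_ball
  -- With `y = f(θs + tv) - f(θs)`, the function `(e^{-y} - 1 + y)/t²` is nonnegative. Since `E
  -- e^{-y} = 1`, its mean is the increment of `F₀` over `t²`. Comparing its pointwise limit with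
  -- the limit of its means by Fatou gives the inequality without dominating any second derivative
  -- of the densities.
  set ψ : ℝ → 𝒳 → ℝ := fun t x => (Real.exp (-(f (θs + t • v) x - f θs x)) - 1
    + (f (θs + t • v) x - f θs x)) / t ^ 2 with hψ
  have hpt : ∀ x, Tendsto (fun t => ψ t x) (𝓝[>] 0)
      (𝓝 ((inner ℝ v (gradient (fun η => f η x) θs) : ℝ) ^ 2 / 2)) := by
    intro x
    set y : ℝ → ℝ := fun t => f (θs + t • v) x - f θs x with hy
    set y' : ℝ → ℝ := fun t => inner ℝ v (gradient (fun η => f η x) (θs + t • v)) with hy'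
    have h1 : ∀ᶠ t in 𝓝 0, HasDerivAt y (y' t) t := by
      filter_upwards [hev] with t ht
      exact (hasDerivAt_line (φ := fun η => f η x) (hS.differentiableAt x _ ht)).sub_const _
    have h2 : HasDerivAt y' (inner ℝ v (hessian (fun η => f η x) θs v)) 0 :=
      hasDerivAt_inner_gradient_line (hS.differentiableAt_gradient x θs hS.mem_ball)
    have y0 : y 0 = 0 := by simp [hy]
    have y0' : y' 0 = inner ℝ v (gradient (fun η => f η x) θs) := by simp [hy']
    refine tendsto_div_sq_of_hasDerivAt (g := fun t => Real.exp (-y t) - 1 + y t)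
      (g' := fun t => Real.exp (-y t) * -y' t + y' t) ?_ (by simp [y0]) (by simp [y0]) ?_
    · filter_upwards [h1] with t ht
      exact (ht.neg.exp.sub_const 1).add ht
    -- The second derivative of `e^{-y} + y` at 0 is `y'² - y'' + y''`: the Hessian cancels and only
    -- the squared score remains.
    · have := (h1.self_of_nhds.neg.exp.mul h2.neg).add h2
      refine HasDerivAt.congr_deriv this ?_
      simp only [y0, ← y0', neg_zero, Real.exp_zero, Pi.neg_apply]; ring
  have hpop : Tendsto (fun t => (popRisk f P (θs + t • v) - popRisk f P θs) / t ^ 2) (𝓝[>] 0)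
      (𝓝 ((inner ℝ v (hessian (popRisk f P) θs v) : ℝ) / 2)) := by
    refine tendsto_div_sq_of_hasDerivAt
      (g := fun t => popRisk f P (θs + t • v) - popRisk f P θs)
      (g' := fun t => inner ℝ v (gradient (popRisk f P) (θs + t • v))) ?_ (by simp) ?_
      (hasDerivAt_inner_gradient_line (hC.differentiableAt_gradient θs hS.mem_ball))
    · filter_upwards [hev] with t ht
      exact (hasDerivAt_line (hC.differentiableAt _ ht)).sub_const _
    · simp [hP.gradient_popRisk_eq_zero]
  have hint : ∀ t : ℝ, θs + t • v ∈ Metric.ball θs ρ → Integrable (ψ t) P ∧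
      ∫ x, ψ t x ∂P = (popRisk f P (θs + t • v) - popRisk f P θs) / t ^ 2 := by
    intro t ht
    have hmem := hS.ball_subset ht
    have i1 : Integrable (fun x => Real.exp (-(f (θs + t • v) x - f θs x))) P :=
      integrable_of_integral_eq_one (hone _ hmem)
    have i2 : Integrable (fun x => f (θs + t • v) x - f θs x) P :=
      (hP.integrable_loss _ hmem).sub (hP.integrable_loss _ hθs)
    have i3 : Integrable (fun x => Real.exp (-(f (θs + t • v) x - f θs x)) - 1) P :=
      i1.sub (integrable_const 1)
    refine ⟨(i3.add i2).div_const _, ?_⟩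
    simp only [hψ]
    rw [integral_div, integral_add i3 i2, integral_sub i1 (integrable_const 1), hone _ hmem,
      integral_sub (hP.integrable_loss _ hmem) (hP.integrable_loss _ hθs)]
    simp [popRisk]
  have hnn : ∀ t x, 0 ≤ ψ t x := fun t x => by
    have := Real.add_one_le_exp (-(f (θs + t • v) x - f θs x))
    exact div_nonneg (by linarith) (sq_nonneg t)
  -- Fatou's lemma is applied along a sequence of positive `t` tending to 0, shifted so that every
  -- point stays in the ball.
  obtain ⟨u, -, hu0, hu⟩ := exists_seq_strictAnti_tendsto' (x := (0 : ℝ)) (y := 1) one_pos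
  have hu' : Tendsto u atTop (𝓝[>] 0) :=
    tendsto_nhdsWithin_iff.2 ⟨hu, Eventually.of_forall fun n => (hu0 n).1⟩
  have hmψ : ∀ᶠ n in atTop, θs + u n • v ∈ Metric.ball θs ρ := hu.eventually hev
  obtain ⟨N, hN⟩ := eventually_atTop.1 hmψ
  have hw : Tendsto (fun n => u (n + N)) atTop (𝓝[>] 0) := hu'.comp (tendsto_add_atTop_nat N)
  have hb : ∀ n, θs + u (n + N) • v ∈ Metric.ball θs ρ := fun n => hN _ (Nat.le_add_left _ _)
  have hmeas : ∀ n, Measurable (fun x => ENNReal.ofReal (ψ (u (n + N)) x)) := fun n => by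
    have a := hm _ (hS.ball_subset (hb n))
    have b := hm _ hθs
    exact (((((a.sub b).neg).exp.sub_const 1).add (a.sub b)).div_const _).ennreal_ofReal
  have fatou := lintegral_liminf_le (μ := P) (u := atTop)
    (f := fun n x => ENNReal.ofReal (ψ (u (n + N)) x)) hmeas
  have e1 : ∀ x, liminf (fun n => ENNReal.ofReal (ψ (u (n + N)) x)) atTop
      = ENNReal.ofReal ((inner ℝ v (gradient (fun η => f η x) θs) : ℝ) ^ 2 / 2) := fun x =>
    (ENNReal.tendsto_ofReal ((hpt x).comp hw)).liminf_eq
  have e2 : ∀ n, ∫⁻ x, ENNReal.ofReal (ψ (u (n + N)) x) ∂P = ENNReal.ofReal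
      ((popRisk f P (θs + u (n + N) • v) - popRisk f P θs) / u (n + N) ^ 2) := fun n => by
    rw [← (hint _ (hb n)).2, ofReal_integral_eq_lintegral_ofReal (hint _ (hb n)).1
      (Eventually.of_forall fun x => hnn _ x)]
  simp_rw [e1, e2] at fatou
  have e3 : liminf (fun n => ENNReal.ofReal
      ((popRisk f P (θs + u (n + N) • v) - popRisk f P θs) / u (n + N) ^ 2)) atTop
      = ENNReal.ofReal ((inner ℝ v (hessian (popRisk f P) θs v) : ℝ) / 2) :=
    (ENNReal.tendsto_ofReal (hpop.comp hw)).liminf_eq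
  rw [e3,
    ← ofReal_integral_eq_lintegral_ofReal
      ((hS.integrable_inner_gradient_sq hm v).div_const 2)
      (Eventually.of_forall fun x => by positivity), integral_div] at fatou
  have hpos : 0 ≤ (inner ℝ v (hessian (popRisk f P) θs v) : ℝ) / 2 := by
    have h1 := hC.curvature v
    have h2 := hC.lam_pos
    have : 0 ≤ lam * ‖v‖ ^ 2 := by positivity
    linarith
  have := (ENNReal.ofReal_le_ofReal_iff hpos).1 fatou
  linarith

/-- The Fisher information is positive definite. -/
lemma integral_inner_gradient_sq_pos [IsProbabilityMeasure P]
    (hP : ParameterAssumption Θ f P θs R) (hS : SmoothnessAssumption Θ f P θs ρ G H L)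
    (hm : ∀ θ ∈ Θ, Measurable (f θ))
    (hone : ∀ θ ∈ Θ, ∫ x, Real.exp (-(f θ x - f θs x)) ∂P = 1) {v : 𝔼} (hv : v ≠ 0) :
    0 < ∫ x, (inner ℝ v (gradient (fun η => f η x) θs) : ℝ) ^ 2 ∂P := by
  have hθs : θs ∈ Θ := hS.ball_subset hS.mem_ball
  refine lt_of_le_of_ne (integral_nonneg fun x => by positivity) fun h0 => ?_
  have hz := (integral_eq_zero_iff_of_nonneg (fun x => by positivity)
    (hS.integrable_inner_gradient_sq hm v)).1 h0.symm
  have hvp : 0 < ‖v‖ := norm_pos_iff.2 hv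
  have hρ := hS.rho_pos
  set t := ρ / 2 / ‖v‖ with ht
  have htp : 0 < t := by positivity
  set θ := θs + t • v with hθdef
  have hθ : θ ∈ Metric.ball θs ρ := by
    rw [mem_ball_iff_norm, hθdef, add_sub_cancel_left, norm_smul, Real.norm_of_nonneg htp.le, ht]
    field_simp; norm_num
  have hθΘ := hS.ball_subset hθ
  have hne : θ ≠ θs := by simp [hθdef, htp.ne', hv]
  -- A vanishing quadratic form makes the derivative along `v` zero almost surely, so convexity
  -- gives `f θ ≥ f θs`. The likelihood ratio is then at most 1 with mean 1, hence equal to 1 almost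
  -- surely, and `θ` would be a second minimizer.
  have hnn : ∀ᵐ x ∂P, 0 ≤ f θ x - f θs x := by
    filter_upwards [hz] with x hx
    have hx' : (inner ℝ v (gradient (fun η => f η x) θs) : ℝ) = 0 := by simpa using hx
    have := (hP.convexOn_loss x).add_fderiv_apply_sub_le hθs hθΘ
      (hS.differentiableAt x θs hS.mem_ball).hasFDerivAt
    rw [hθdef, add_sub_cancel_left, map_smul, ← inner_gradient_eq_fderiv, hx'] at this
    simp only [smul_zero, add_zero] at this
    linarith
  have i1 : Integrable (fun x => Real.exp (-(f θ x - f θs x))) P :=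
    integrable_of_integral_eq_one (hone _ hθΘ)
  have h1 : ∫ x, (1 - Real.exp (-(f θ x - f θs x))) ∂P = 0 := by
    rw [integral_sub (integrable_const 1) i1, hone _ hθΘ]; simp
  have h2 := (integral_eq_zero_iff_of_nonneg_ae (by
    filter_upwards [hnn] with x hx
    have : Real.exp (-(f θ x - f θs x)) ≤ 1 := Real.exp_le_one_iff.2 (by linarith)
    simp only [Pi.zero_apply, Pi.sub_apply]; linarith) ((integrable_const 1).sub i1)).1 h1
  have h3 : popRisk f P θ = popRisk f P θs := by
    refine integral_congr_ae ?_
    filter_upwards [h2] with x hx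
    have : Real.exp (-(f θ x - f θs x)) = 1 := by
      simp only [Pi.zero_apply, Pi.sub_apply] at hx; linarith
    rw [Real.exp_eq_one_iff] at this
    linarith
  exact (hP.isUniqueMin θ hθΘ hne).ne' h3

open Matrix in
/-- If `M` is positive definite and bounded by `S` as a quadratic form, then
`tr(S⁻¹ M S⁻ᵀ) ≤ tr(M⁻¹)`. -/
lemma sum_quadratic_adjoint_le_trace_inv {M : Matrix (Fin d) (Fin d) ℝ} (hsymm : Mᵀ = M)
    (hpos : ∀ v : 𝔼, v ≠ 0 → 0 < v.ofLp ⬝ᵥ M *ᵥ v.ofLp) {S B : 𝔼 →L[ℝ] 𝔼}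
    (hBS : ∀ v, B (S v) = v) (hle : ∀ v : 𝔼, v.ofLp ⬝ᵥ M *ᵥ v.ofLp ≤ inner ℝ v (S v)) :
    ∑ i, (ContinuousLinearMap.adjoint B (EuclideanSpace.single i 1)).ofLp ⬝ᵥ
      M *ᵥ (ContinuousLinearMap.adjoint B (EuclideanSpace.single i 1)).ofLp ≤ M⁻¹.trace := by
  have hdet : IsUnit M.det := by
    rw [isUnit_iff_ne_zero]
    intro h0
    obtain ⟨v, hv, hMv⟩ := Matrix.exists_mulVec_eq_zero_iff.2 h0
    have := hpos (WithLp.toLp 2 v) (by simpa using hv)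
    simp [hMv] at this
  have hpos' : ∀ v : Fin d → ℝ, 0 ≤ v ⬝ᵥ M *ᵥ v := fun v => by
    rcases eq_or_ne v 0 with rfl | hv
    · simp
    · exact (hpos (WithLp.toLp 2 v) (by simpa using hv)).le
  rw [Matrix.trace]
  refine Finset.sum_le_sum fun i _ => ?_
  set u := ContinuousLinearMap.adjoint B (EuclideanSpace.single i 1) with hu
  -- For `u = Bᵀeᵢ`, `uᵀMu ≤ uᵀSu = ⟨eᵢ, BSu⟩ = uᵢ`.
  have h1 : u.ofLp ⬝ᵥ M *ᵥ u.ofLp ≤ u.ofLp i := by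
    refine (hle u).trans_eq ?_
    conv_lhs => rw [hu]
    rw [ContinuousLinearMap.adjoint_inner_left, ← hu, hBS, EuclideanSpace.inner_single_left]
    simp
  -- Expanding `0 ≤ (u - w)ᵀM(u - w) = uᵀMu - 2uᵢ + (M⁻¹)ᵢᵢ` and using `h1` gives `uᵀMu ≤ uᵢ ≤
  -- (M⁻¹)ᵢᵢ`.
  set w : Fin d → ℝ := M⁻¹ *ᵥ Pi.single i 1 with hw
  have hMw : M *ᵥ w = Pi.single i 1 := by
    rw [hw, mulVec_mulVec, mul_nonsing_inv _ hdet, one_mulVec]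
  have h2 := hpos' (u.ofLp - w)
  have h3 : w ⬝ᵥ M *ᵥ u.ofLp = u.ofLp i := by
    rw [dotProduct_mulVec, ← mulVec_transpose, hsymm, hMw]; simp
  rw [mulVec_sub, dotProduct_sub, sub_dotProduct, sub_dotProduct, h3, hMw] at h2
  simp only [dotProduct_single, mul_one] at h2
  have hwi : w i = M⁻¹ i i := by simp [hw]
  rw [hwi] at h2
  simp only [Matrix.diag_apply]
  linarith

/-- The asymptotic variance is bounded by the trace of the inverse Fisher information. -/
lemma integral_norm_sq_le_trace_inv_fisherInformation [IsProbabilityMeasure P]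
    (hP : ParameterAssumption Θ f P θs R)
    (hC : LocalStrongConvexity f P θs ρ lam) (hS : SmoothnessAssumption Θ f P θs ρ G H L)
    (hm : ∀ θ ∈ Θ, Measurable (f θ)) (hfam : IsParametricFamily Θ ν p)
    (hf : ∀ θ ∈ Θ, ∀ x, f θ x = negLogLikelihood p θ x) (hPm : P = modelMeasure ν p θs)
    {B : 𝔼 →L[ℝ] 𝔼} (hB : ∀ v, B (hessian (popRisk f P) θs v) = v) :
    ∫ x, ‖B (gradient (fun η => f η x) θs)‖ ^ 2 ∂P ≤ ((fisherInformation ν p θs)⁻¹).trace := by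
  have hθs : θs ∈ Θ := hS.ball_subset hS.mem_ball
  have hone : ∀ θ ∈ Θ, ∫ x, Real.exp (-(f θ x - f θs x)) ∂P = 1 := fun θ hθ =>
    integral_exp_neg_loss_sub hfam hf hPm hθs hθ
  set g : 𝒳 → 𝔼 := fun x => gradient (fun η => f η x) θs with hg
  -- The two losses agree only on `Θ`; the gradients agree because `θs` is interior.
  have hgeq : ∀ x, gradient (fun η => negLogLikelihood p η x) θs = g x := fun x => by
    refine Filter.EventuallyEq.gradient_eq ?_
    filter_upwards [mem_interior_iff_mem_nhds.1 hP.mem_interior] with η hη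
    exact (hf η hη x).symm
  have hgm : Measurable g := hS.measurable_gradient hm hS.mem_ball
  have hgmi : ∀ i, Measurable (fun x => g x i) := fun i =>
    (show Measurable (fun v : 𝔼 => v i) by fun_prop).comp hgm
  have hI : ∀ i j, fisherInformation ν p θs i j = ∫ x, g x i * g x j ∂P := fun i j => by
    rw [fisherInformation, Matrix.of_apply, hPm]
    simp_rw [hgeq]
  have h2 := integrable_pow_of_le hgm.norm.aestronglyMeasurable (show 2 ≤ 8 by norm_num)
    (hS.gradient_moment θs hS.mem_ball).1
  have hij : ∀ i j, Integrable (fun x => g x i * g x j) P := fun i j => by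
    refine h2.mono' ((hgmi i).mul (hgmi j)).aestronglyMeasurable
      (Filter.Eventually.of_forall fun x => ?_)
    rw [norm_mul, pow_two]
    exact mul_le_mul (PiLp.norm_apply_le _ _) (PiLp.norm_apply_le _ _) (norm_nonneg _)
      (norm_nonneg _)
  have hQ : ∀ v : 𝔼, v.ofLp ⬝ᵥ (fisherInformation ν p θs).mulVec v.ofLp
      = ∫ x, (inner ℝ v (g x) : ℝ) ^ 2 ∂P := fun v => by
    have e : ∀ x, (inner ℝ v (g x) : ℝ) ^ 2 = ∑ i, ∑ j, v i * v j * (g x i * g x j) := fun x => by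
      rw [PiLp.inner_apply, pow_two, Finset.sum_mul_sum]
      refine Finset.sum_congr rfl fun i _ => Finset.sum_congr rfl fun j _ => ?_
      simp; ring
    simp_rw [e]
    rw [integral_finsetSum _ fun i _ => integrable_finsetSum _ fun j _ => (hij i j).const_mul _]
    simp_rw [integral_finsetSum _ fun j _ => (hij _ j).const_mul _, integral_const_mul, ← hI]
    simp only [dotProduct, Matrix.mulVec, Finset.mul_sum]
    refine Finset.sum_congr rfl fun i _ => Finset.sum_congr rfl fun j _ => ?_
    ring
  have hsymm : (fisherInformation ν p θs).transpose = fisherInformation ν p θs := by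
    ext i j
    rw [Matrix.transpose_apply, hI, hI]
    congr 1; ext x; ring
  refine le_trans (le_of_eq ?_) (sum_quadratic_adjoint_le_trace_inv hsymm
    (fun v hv => by rw [hQ]; exact integral_inner_gradient_sq_pos hP hS hm hone hv) hB
    (fun v => by rw [hQ]; exact integral_inner_gradient_sq_le hP hC hS hm hone v))
  simp_rw [hQ]
  rw [← integral_finsetSum _ fun i _ => hS.integrable_inner_gradient_sq hm _]
  congr 1; ext x
  rw [EuclideanSpace.real_norm_sq_eq]
  refine Finset.sum_congr rfl fun i _ => ?_
  rw [ContinuousLinearMap.adjoint_inner_left, EuclideanSpace.inner_single_left]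
  simp

end Fisher

/-! ### Averages of independent vectors and operators. -/

section Averages

variable {d : ℕ} {Ω 𝒳 : Type*} [MeasurableSpace Ω] {μ : Measure Ω} [MeasurableSpace 𝒳]
  {P : Measure 𝒳}

local notation "𝔼" => EuclideanSpace ℝ (Fin d)

/-- Bias-variance bound for an average of pairwise independent random vectors. -/
lemma integral_norm_average_sq_le {m : ℕ} (hm : 0 < m) [IsProbabilityMeasure μ] {Y : Fin m → Ω → 𝔼}
    (hind : ∀ i j, i ≠ j → IndepFun (Y i) (Y j) μ) (hint : ∀ i, Integrable (Y i) μ)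
    (hint2 : ∀ i, Integrable (fun ω => ‖Y i ω‖ ^ 2) μ) {α β : ℝ}
    (hα : ∀ i, ∫ ω, ‖Y i ω‖ ^ 2 ∂μ ≤ α) (hβ : ∀ i, ‖∫ ω, Y i ω ∂μ‖ ≤ β) :
    ∫ ω, ‖(1 / (m : ℝ)) • ∑ i, Y i ω‖ ^ 2 ∂μ ≤ α / m + β ^ 2 := by
  have e : ∀ ω, ‖(1 / (m : ℝ)) • ∑ i, Y i ω‖ ^ 2
      = (1 / (m : ℝ)) ^ 2 * ∑ i, ∑ j, (inner ℝ (Y i ω) (Y j ω) : ℝ) := fun ω => by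
    rw [norm_smul, mul_pow, Real.norm_of_nonneg (by positivity), ← real_inner_self_eq_norm_sq,
      sum_inner]
    simp_rw [inner_sum]
  have hij : ∀ i j, Integrable (fun ω => (inner ℝ (Y i ω) (Y j ω) : ℝ)) μ := fun i j => by
    refine ((hint2 i).add (hint2 j)).mono' ((hint i).1.inner (hint j).1)
      (Filter.Eventually.of_forall fun ω => ?_)
    have := abs_real_inner_le_norm (Y i ω) (Y j ω)
    simp only [Pi.add_apply, Real.norm_eq_abs]
    nlinarith [sq_nonneg (‖Y i ω‖ - ‖Y j ω‖), sq_nonneg (‖Y i ω‖ + ‖Y j ω‖)]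
  -- Off the diagonal, independence turns the expectation into an inner product of means. Allowing
  -- `β ^ 2` on the diagonal too makes the double sum exactly `m α + m² β²`.
  have hle : ∀ i j, ∫ ω, (inner ℝ (Y i ω) (Y j ω) : ℝ) ∂μ ≤ (if i = j then α else 0) + β ^ 2 := by
    intro i j
    split_ifs with h
    · subst h
      simp_rw [real_inner_self_eq_norm_sq]
      have := hα i
      nlinarith [sq_nonneg β]
    · have h1 : ∫ ω, (inner ℝ (Y i ω) (Y j ω) : ℝ) ∂μ
          = inner ℝ (∫ ω, Y i ω ∂μ) (∫ ω, Y j ω ∂μ) :=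
        (hind i j h).integral_bilin (hint i) (hint j) (innerSL ℝ)
      rw [h1, zero_add, pow_two]
      exact (real_inner_le_norm _ _).trans (mul_le_mul (hβ i) (hβ j) (norm_nonneg _)
        ((norm_nonneg _).trans (hβ i)))
  simp_rw [e]
  rw [integral_const_mul, integral_finsetSum _ fun i _ => integrable_finsetSum _ fun j _ => hij i j]
  simp_rw [integral_finsetSum _ fun j _ => hij _ j]
  have hm' : (0 : ℝ) < m := by exact_mod_cast hm
  calc (1 / (m : ℝ)) ^ 2 * ∑ i, ∑ j, ∫ ω, (inner ℝ (Y i ω) (Y j ω) : ℝ) ∂μ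
      ≤ (1 / (m : ℝ)) ^ 2 * ∑ i : Fin m, ∑ j : Fin m, ((if i = j then α else 0) + β ^ 2) := by
        gcongr with i _ j _
        exact hle i j
    _ = α / m + β ^ 2 := by
      simp [Finset.sum_add_distrib]; field_simp

lemma integral_mul_le_sqrt_mul_sqrt {a b : 𝒳 → ℝ} (ha : ∀ x, 0 ≤ a x) (hb : ∀ x, 0 ≤ b x)
    (ham : AEStronglyMeasurable a P) (hbm : AEStronglyMeasurable b P)
    (ha2 : Integrable (fun x => a x ^ 2) P) (hb2 : Integrable (fun x => b x ^ 2) P) :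
    ∫ x, a x * b x ∂P ≤ √(∫ x, a x ^ 2 ∂P) * √(∫ x, b x ^ 2 ∂P) := by
  have h := integral_mul_le_Lp_mul_Lq_of_nonneg (μ := P) Real.HolderConjugate.two_two
    (Filter.Eventually.of_forall ha) (Filter.Eventually.of_forall hb)
    (by simpa using (memLp_two_iff_integrable_sq ham).2 ha2)
    (by simpa using (memLp_two_iff_integrable_sq hbm).2 hb2)
  simpa [Real.sqrt_eq_rpow] using h

variable {n : ℕ} {X : Fin n → Ω → 𝒳}

lemma fourth_moment_norm_empirical_average_le (hn : 0 < n) (hX : ∀ j, Measurable (X j))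
    (hlaw : ∀ j, μ.map (X j) = P) (hind : iIndepFun X μ) {φ : 𝒳 → 𝔼} (hφ : Measurable φ)
    (hzero : ∫ x, φ x ∂P = 0) {M : ℝ} (hint : Integrable (fun x => ‖φ x‖ ^ 4) P)
    (hle : ∫ x, ‖φ x‖ ^ 4 ∂P ≤ M) :
    Integrable (fun ω => ‖(1 / (n : ℝ)) • ∑ j, φ (X j ω)‖ ^ 4) μ ∧
      ∫ ω, ‖(1 / (n : ℝ)) • ∑ j, φ (X j ω)‖ ^ 4 ∂μ ≤ 3 * (d : ℝ) ^ 2 * M / (n : ℝ) ^ 2 := by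
  have hm4 : Measurable (fun x => ‖φ x‖ ^ 4) := hφ.norm.pow_const 4
  refine fourth_moment_norm_average_le hn (Y := fun j ω => φ (X j ω)) (hind.comp _ fun _ => hφ)
    (fun j => hφ.comp (hX j)) (fun j => ?_) (fun j => ?_) (fun j => ?_)
  · rw [← integral_map (hX j).aemeasurable hφ.aestronglyMeasurable, hlaw, hzero]
  · rw [← hlaw j] at hint
    exact hint.comp_measurable (hX j)
  · rw [← integral_map (f := fun x => ‖φ x‖ ^ 4) (hX j).aemeasurable hm4.aestronglyMeasurable,
      hlaw]
    exact hle

lemma fourth_moment_empirical_average_le (hn : 0 < n) (hX : ∀ j, Measurable (X j))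
    (hlaw : ∀ j, μ.map (X j) = P) (hind : iIndepFun X μ) {φ : 𝒳 → ℝ} (hφ : Measurable φ)
    (hzero : ∫ x, φ x ∂P = 0) {M : ℝ} (hint : Integrable (fun x => φ x ^ 4) P)
    (hle : ∫ x, φ x ^ 4 ∂P ≤ M) :
    Integrable (fun ω => (1 / (n : ℝ) * ∑ j, φ (X j ω)) ^ 4) μ ∧
      ∫ ω, (1 / (n : ℝ) * ∑ j, φ (X j ω)) ^ 4 ∂μ ≤ 3 * M / (n : ℝ) ^ 2 := by
  have hm4 : Measurable (fun x => φ x ^ 4) := hφ.pow_const 4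
  obtain ⟨h1, -, h3⟩ := fourth_moment_sum_le (Y := fun j ω => φ (X j ω)) (M := M)
    (hind.comp _ fun _ => hφ) (fun j => hφ.comp (hX j))
    (fun j => by
      rw [← integral_map (hX j).aemeasurable hφ.aestronglyMeasurable, hlaw, hzero])
    (fun j => by
      rw [← hlaw j] at hint
      exact hint.comp_measurable (hX j))
    (fun j => by
      rw [← integral_map (f := fun x => φ x ^ 4) (hX j).aemeasurable hm4.aestronglyMeasurable,
        hlaw]
      exact hle) Finset.univ
  simp_rw [mul_pow]
  refine ⟨h1.const_mul _, ?_⟩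
  rw [integral_const_mul]
  have hn' : (0 : ℝ) < n := by exact_mod_cast hn
  simp only [Finset.card_univ, Fintype.card_fin] at h3
  calc (1 / (n : ℝ)) ^ 4 * ∫ ω, (∑ j, φ (X j ω)) ^ 4 ∂μ
      ≤ (1 / (n : ℝ)) ^ 4 * (3 * (n : ℝ) ^ 2 * M) := by gcongr
    _ = 3 * M / (n : ℝ) ^ 2 := by field_simp

lemma integral_norm_empirical_average_sq_le (hn : 0 < n) (hX : ∀ j, Measurable (X j))
    (hlaw : ∀ j, μ.map (X j) = P) (hind : iIndepFun X μ) {φ : 𝒳 → 𝔼} (hφ : Measurable φ)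
    (hzero : ∫ x, φ x ∂P = 0) (hi : Integrable φ P) (hint : Integrable (fun x => ‖φ x‖ ^ 2) P) :
    ∫ ω, ‖(1 / (n : ℝ)) • ∑ j, φ (X j ω)‖ ^ 2 ∂μ ≤ (∫ x, ‖φ x‖ ^ 2 ∂P) / n := by
  have := hind.isProbabilityMeasure
  have hm2 : Measurable (fun x => ‖φ x‖ ^ 2) := hφ.norm.pow_const 2
  have h := integral_norm_average_sq_le hn (Y := fun j ω => φ (X j ω)) (β := 0) (μ := μ)
    (α := ∫ x, ‖φ x‖ ^ 2 ∂P) (fun i j hij => (hind.indepFun hij).comp hφ hφ)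
    (fun j => by
      rw [← hlaw j] at hi
      exact hi.comp_measurable (hX j))
    (fun j => by
      rw [← hlaw j] at hint
      exact hint.comp_measurable (hX j))
    (fun j => by
      rw [← integral_map (f := fun x => ‖φ x‖ ^ 2) (hX j).aemeasurable hm2.aestronglyMeasurable,
        hlaw])
    (fun j => by
      rw [← integral_map (hX j).aemeasurable hφ.aestronglyMeasurable, hlaw, hzero, norm_zero])
  simpa using h

/-- The product of the averages of centred operators and of centred vectors has expectation of
order `1 / n`, with the correlation on a single sample as the constant. -/
lemma norm_integral_average_apply_average_le (hn : 0 < n) (hX : ∀ j, Measurable (X j))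
    (hlaw : ∀ j, μ.map (X j) = P) (hind : iIndepFun X μ) {A : 𝒳 → 𝔼 →L[ℝ] 𝔼} {φ : 𝒳 → 𝔼}
    (hA : StronglyMeasurable A) (hφ : Measurable φ) (hAi : Integrable A P) (hφi : Integrable φ P)
    (hφz : ∫ x, φ x ∂P = 0)
    (hA2 : Integrable (fun x => ‖A x‖ ^ 2) P) (hφ2 : Integrable (fun x => ‖φ x‖ ^ 2) P) :
    ‖∫ ω, ((1 / (n : ℝ)) • ∑ i, A (X i ω)) ((1 / (n : ℝ)) • ∑ j, φ (X j ω)) ∂μ‖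
      ≤ √(∫ x, ‖A x‖ ^ 2 ∂P) * √(∫ x, ‖φ x‖ ^ 2 ∂P) / n := by
  have hAφm : StronglyMeasurable (fun x => A x (φ x)) :=
    (ContinuousLinearMap.id ℝ (𝔼 →L[ℝ] 𝔼)).continuous₂.comp_stronglyMeasurable
      (hA.prodMk hφ.stronglyMeasurable)
  have hab : Integrable (fun x => ‖A x‖ * ‖φ x‖) P := by
    refine (hA2.add hφ2).mono' (hA.norm.mul hφ.stronglyMeasurable.norm).aestronglyMeasurable
      (Filter.Eventually.of_forall fun x => ?_)
    simp only [Pi.add_apply]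
    rw [Real.norm_of_nonneg (by positivity)]
    nlinarith [sq_nonneg (‖A x‖ - ‖φ x‖), sq_nonneg (‖A x‖ + ‖φ x‖)]
  have hAφi : Integrable (fun x => A x (φ x)) P :=
    hab.mono' hAφm.aestronglyMeasurable
      (Filter.Eventually.of_forall fun x => (A x).le_opNorm _)
  set D := √(∫ x, ‖A x‖ ^ 2 ∂P) * √(∫ x, ‖φ x‖ ^ 2 ∂P) with hD
  have hcomp : ∀ {W : Type} [NormedAddCommGroup W] {ψ : 𝒳 → W} (_ : Integrable ψ P) (j),
      Integrable (fun ω => ψ (X j ω)) μ := fun hψ j => by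
    rw [← hlaw j] at hψ
    exact hψ.comp_measurable (hX j)
  have hindA : ∀ i j, i ≠ j → IndepFun (fun ω => A (X i ω)) (fun ω => φ (X j ω)) μ :=
    fun i j hij => (hind.indepFun hij).comp hA.measurable hφ
  have hij : ∀ i j, Integrable (fun ω => A (X i ω) (φ (X j ω))) μ := fun i j => by
    rcases eq_or_ne i j with rfl | h
    · exact hcomp hAφi i
    · exact (hindA i j h).integrable_bilin (hcomp hAi i) (hcomp hφi j)
        (ContinuousLinearMap.id ℝ (𝔼 →L[ℝ] 𝔼))
  -- Distinct samples factor into `(E A)(E φ) = 0`. The `n` diagonal terms are bounded by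
  -- Cauchy–Schwarz, and `n / n²` gives the rate.
  have hle : ∀ i j, ‖∫ ω, A (X i ω) (φ (X j ω)) ∂μ‖ ≤ if i = j then D else 0 := by
    intro i j
    split_ifs with h
    · subst h
      rw [← integral_map (f := fun x => A x (φ x)) (hX i).aemeasurable
        hAφm.aestronglyMeasurable, hlaw]
      refine (norm_integral_le_integral_norm _).trans ?_
      refine (integral_mono hAφi.norm hab fun x => (A x).le_opNorm _).trans ?_
      exact integral_mul_le_sqrt_mul_sqrt (fun _ => norm_nonneg _) (fun _ => norm_nonneg _)
        hA.norm.aestronglyMeasurable hφ.norm.aestronglyMeasurable hA2 hφ2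
    · have h1 := (hindA i j h).integral_bilin (hcomp hAi i) (hcomp hφi j)
        (ContinuousLinearMap.id ℝ (𝔼 →L[ℝ] 𝔼))
      simp only [ContinuousLinearMap.id_apply] at h1
      rw [h1, ← integral_map (f := φ) (hX j).aemeasurable hφ.aestronglyMeasurable, hlaw, hφz]
      simp
  have e : ∀ ω, ((1 / (n : ℝ)) • ∑ i, A (X i ω)) ((1 / (n : ℝ)) • ∑ j, φ (X j ω))
      = (1 / (n : ℝ)) ^ 2 • ∑ i, ∑ j, A (X i ω) (φ (X j ω)) := fun ω => by
    simp only [map_smul, map_sum, smul_apply, pow_two, mul_smul,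
      sum_apply]
    rw [Finset.sum_comm]
    simp [Finset.smul_sum]
  simp_rw [e]
  rw [integral_smul, integral_finsetSum _ fun i _ => integrable_finsetSum _ fun j _ => hij i j]
  simp_rw [integral_finsetSum _ fun j _ => hij _ j]
  rw [norm_smul, Real.norm_of_nonneg (by positivity)]
  have hn' : (0 : ℝ) < n := by exact_mod_cast hn
  calc (1 / (n : ℝ)) ^ 2 * ‖∑ i, ∑ j, ∫ ω, A (X i ω) (φ (X j ω)) ∂μ‖
      ≤ (1 / (n : ℝ)) ^ 2 * ∑ i : Fin n, ∑ j : Fin n, (if i = j then D else 0) := by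
        gcongr
        exact norm_sum_le_of_le _ fun i _ => norm_sum_le_of_le _ fun j _ => hle i j
    _ = D / n := by
      simp; field_simp

end Averages

/-! ### Second order expansion of the error and its moments. -/

section Perturbation

local notation "𝔼" d => EuclideanSpace ℝ (Fin d)

/-- A bounded perturbation that satisfies a perturbed linear equation whenever the data are small
has a second order expansion in the size of the data. -/
lemma exists_remainder_bounds {lam R L τ : ℝ} (hlam : 0 < lam) (hR : 0 ≤ R) (hL : 0 ≤ L)
    (hτ : 0 < τ) (hτ1 : τ ≤ 1) : ∃ C₁ C₂ : ℝ, 0 ≤ C₁ ∧ 0 ≤ C₂ ∧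
      ∀ {d : ℕ} {S A B : (𝔼 d) →L[ℝ] (𝔼 d)} {g Δ : 𝔼 d} {l ℓ : ℝ},
        (∀ w, ‖B w‖ ≤ lam⁻¹ * ‖w‖) → (∀ v, B (S v) = v) → ‖Δ‖ ≤ R → l ≤ L →
        (‖g‖ + ‖A‖ + |ℓ| ≤ τ → ‖Δ‖ ≤ 2 / lam * ‖g‖ ∧ ‖g + (S + A) Δ‖ ≤ (l + ℓ) * ‖Δ‖ ^ 2) →
        ‖Δ + B g‖ ≤ C₁ * (‖g‖ + ‖A‖ + |ℓ|) ^ 2 ∧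
        ‖Δ + B g - B (A (B g))‖ ≤ C₂ * (‖g‖ + ‖A‖ + |ℓ|) ^ 3 + lam⁻¹ * L * ‖Δ‖ ^ 2 := by
  set κ := lam⁻¹ with hκ
  have hκ0 : 0 < κ := inv_pos.2 hlam
  -- The first summand serves the case `Z ≤ τ`; the other two serve `Z > τ`.
  set C₁ := κ * (2 * κ + 4 * κ ^ 2 * (L + 1)) + R / τ ^ 2 + κ / τ with hC₁
  have hC₁0 : 0 ≤ C₁ := by positivity
  refine ⟨C₁, 4 * κ ^ 3 + κ * C₁ + (C₁ + κ ^ 2) / τ, hC₁0, by positivity, ?_⟩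
  intro d S A B g Δ l ℓ hB hBS hΔ hl hgood
  set Z := ‖g‖ + ‖A‖ + |ℓ| with hZ
  have hng := norm_nonneg g
  have hnA := norm_nonneg A
  have hnℓ := abs_nonneg ℓ
  have hZ0 : 0 ≤ Z := by positivity
  have hgZ : ‖g‖ ≤ Z := by linarith
  have hAZ : ‖A‖ ≤ Z := by linarith
  have hℓZ : |ℓ| ≤ Z := by linarith
  rcases le_or_gt Z τ with hle | hgt
  · obtain ⟨h1, h2⟩ := hgood hle
    have hΔZ : ‖Δ‖ ≤ 2 * κ * Z := by
      refine h1.trans ?_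
      rw [hκ, div_eq_mul_inv]; gcongr
    have hΔ2 : ‖Δ‖ ^ 2 ≤ (2 * κ * Z) ^ 2 := by gcongr
    have hℓ' : ℓ ≤ Z := (le_abs_self ℓ).trans hℓZ
    have hA : ∀ w, ‖A w‖ ≤ Z * ‖w‖ := fun w => (A.le_opNorm w).trans (by gcongr)
    -- Both identities come from `Δ = B (S Δ)`; in the second, `B (A (B g))` is split off so that
    -- `A` acts on the already quadratic error `Δ + B g`.
    have e1 : Δ + B g = B (g + (S + A) Δ) - B (A Δ) := by
      simp [hBS]; abel
    have e2 : Δ + B g - B (A (B g)) = B (g + (S + A) Δ) - B (A (Δ + B g)) := by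
      simp [hBS]; abel
    have b1 : ‖Δ + B g‖ ≤ C₁ * Z ^ 2 := by
      have r1 : ‖g + (S + A) Δ‖ ≤ (L + 1) * (2 * κ * Z) ^ 2 := by
        refine h2.trans ?_
        have : l + ℓ ≤ L + 1 := by linarith
        exact mul_le_mul this hΔ2 (by positivity) (by positivity)
      have r2 : ‖A Δ‖ ≤ Z * (2 * κ * Z) := (hA Δ).trans (by gcongr)
      calc ‖Δ + B g‖ ≤ ‖B (g + (S + A) Δ)‖ + ‖B (A Δ)‖ := by rw [e1]; exact norm_sub_le _ _
        _ ≤ κ * ((L + 1) * (2 * κ * Z) ^ 2) + κ * (Z * (2 * κ * Z)) :=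
          add_le_add ((hB _).trans (by gcongr)) ((hB _).trans (by gcongr))
        _ = κ * (2 * κ + 4 * κ ^ 2 * (L + 1)) * Z ^ 2 := by ring
        _ ≤ C₁ * Z ^ 2 := by
          gcongr
          have : 0 ≤ R / τ ^ 2 := by positivity
          have : 0 ≤ κ / τ := by positivity
          linarith
    refine ⟨b1, ?_⟩
    -- The term `L * ‖Δ‖ ^ 2` keeps its exact constant because it enters the leading part of the
    -- bias; only the fluctuation `ℓ` is absorbed into `Z ^ 3`.
    have r1 : ‖g + (S + A) Δ‖ ≤ L * ‖Δ‖ ^ 2 + Z * (2 * κ * Z) ^ 2 := by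
      refine h2.trans ?_
      have a1 : (l + ℓ) * ‖Δ‖ ^ 2 ≤ (L + Z) * ‖Δ‖ ^ 2 := by gcongr
      have a2 : Z * ‖Δ‖ ^ 2 ≤ Z * (2 * κ * Z) ^ 2 := by gcongr
      linarith
    have r2 : ‖A (Δ + B g)‖ ≤ Z * (C₁ * Z ^ 2) := (hA _).trans (by gcongr)
    calc ‖Δ + B g - B (A (B g))‖ ≤ ‖B (g + (S + A) Δ)‖ + ‖B (A (Δ + B g))‖ := by
          rw [e2]; exact norm_sub_le _ _
      _ ≤ κ * (L * ‖Δ‖ ^ 2 + Z * (2 * κ * Z) ^ 2) + κ * (Z * (C₁ * Z ^ 2)) :=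
        add_le_add ((hB _).trans (by gcongr)) ((hB _).trans (by gcongr))
      _ = (4 * κ ^ 3 + κ * C₁) * Z ^ 3 + κ * L * ‖Δ‖ ^ 2 := by ring
      _ ≤ _ := by
        have h : 0 ≤ (C₁ + κ ^ 2) / τ * Z ^ 3 := by positivity
        have e : (4 * κ ^ 3 + κ * C₁ + (C₁ + κ ^ 2) / τ) * Z ^ 3
            = (4 * κ ^ 3 + κ * C₁) * Z ^ 3 + (C₁ + κ ^ 2) / τ * Z ^ 3 := by ring
        linarith
  -- Bad event: crude bounds multiplied by powers of `Z / τ ≥ 1` acquire the required degree in `Z`,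
  -- so no separate tail probability is needed.
  · have hone : 1 ≤ Z / τ := (one_le_div hτ).2 hgt.le
    have b1 : ‖Δ + B g‖ ≤ C₁ * Z ^ 2 := by
      have a1 : R ≤ R / τ ^ 2 * Z ^ 2 := by
        have : 1 ≤ (Z / τ) ^ 2 := one_le_pow₀ hone
        calc R = R * 1 := by ring
          _ ≤ R * (Z / τ) ^ 2 := by gcongr
          _ = R / τ ^ 2 * Z ^ 2 := by rw [div_pow]; ring
      have a2 : κ * Z ≤ κ / τ * Z ^ 2 := by
        calc κ * Z = κ * Z * 1 := by ring
          _ ≤ κ * Z * (Z / τ) := by gcongr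
          _ = κ / τ * Z ^ 2 := by ring
      have a3 : ‖B g‖ ≤ κ * Z := (hB g).trans (by gcongr)
      calc ‖Δ + B g‖ ≤ ‖Δ‖ + ‖B g‖ := norm_add_le _ _
        _ ≤ (R / τ ^ 2 + κ / τ) * Z ^ 2 := by linarith
        _ ≤ C₁ * Z ^ 2 := by
          gcongr
          have : 0 ≤ κ * (2 * κ + 4 * κ ^ 2 * (L + 1)) := by positivity
          linarith
    refine ⟨b1, ?_⟩
    have a3 : ‖B (A (B g))‖ ≤ κ ^ 2 * Z ^ 2 := by
      calc ‖B (A (B g))‖ ≤ κ * ‖A (B g)‖ := hB _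
        _ ≤ κ * (‖A‖ * ‖B g‖) := by gcongr; exact A.le_opNorm _
        _ ≤ κ * (Z * (κ * Z)) := by gcongr; exact (hB g).trans (by gcongr)
        _ = κ ^ 2 * Z ^ 2 := by ring
    calc ‖Δ + B g - B (A (B g))‖ ≤ ‖Δ + B g‖ + ‖B (A (B g))‖ := norm_sub_le _ _
      _ ≤ (C₁ + κ ^ 2) * Z ^ 2 * 1 := by linarith
      _ ≤ (C₁ + κ ^ 2) * Z ^ 2 * (Z / τ) := by gcongr
      _ = (C₁ + κ ^ 2) / τ * Z ^ 3 := by ring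
      _ ≤ (4 * κ ^ 3 + κ * C₁ + (C₁ + κ ^ 2) / τ) * Z ^ 3 := by
        gcongr
        have : 0 ≤ 4 * κ ^ 3 + κ * C₁ := by positivity
        linarith
      _ ≤ _ := by
        have : 0 ≤ κ * L * ‖Δ‖ ^ 2 := by positivity
        linarith

/-- Both right-hand terms have size `n^{-3/2}` when `Z` has its typical size `n^{-1/2}`, so the
fourth moment controls the third at the correct rate. -/
lemma pow_three_le_sqrt_mul {n Z : ℝ} (hn : 0 < n) (hZ : 0 ≤ Z) :
    Z ^ 3 ≤ √n * Z ^ 4 + 1 / (n * √n) := by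
  have hs : 0 < √n := Real.sqrt_pos.2 hn
  rcases le_or_gt 1 (√n * Z) with h | h
  · have h1 : Z ^ 3 * 1 ≤ Z ^ 3 * (√n * Z) := by gcongr
    have : 0 ≤ 1 / (n * √n) := by positivity
    nlinarith
  · have h1 : (√n * Z) ^ 3 ≤ 1 := pow_le_one₀ (by positivity) h.le
    have h2 : (√n * Z) ^ 3 = (n * √n) * Z ^ 3 := by
      rw [mul_pow, pow_succ, Real.sq_sqrt hn.le]
    have h3 : Z ^ 3 ≤ 1 / (n * √n) := by
      rw [le_div_iff₀ (by positivity)]; linarith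
    have : 0 ≤ √n * Z ^ 4 := by positivity
    linarith

/-- Moments of an estimation error with a second order expansion. -/
lemma expectation_bounds_of_expansion {d : ℕ} {Ω : Type*} [MeasurableSpace Ω] {μ : Measure Ω}
    [IsProbabilityMeasure μ] {g Δ : Ω → 𝔼 d} {A : Ω → (𝔼 d) →L[ℝ] (𝔼 d)}
    {B : (𝔼 d) →L[ℝ] (𝔼 d)} {Z : Ω → ℝ} {n C₁ C₂ c K V W κ R : ℝ}
    (hg : StronglyMeasurable g) (hΔ : StronglyMeasurable Δ) (hA : StronglyMeasurable A)
    (hZ : Measurable Z) (hn : 1 ≤ n) (hC₂ : 0 ≤ C₂) (hc : 0 ≤ c) (hκ : 0 ≤ κ)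
    (hB : ∀ w, ‖B w‖ ≤ κ * ‖w‖) (hgZ : ∀ ω, ‖g ω‖ ≤ Z ω) (hAZ : ∀ ω, ‖A ω‖ ≤ Z ω)
    (hZ4 : Integrable (fun ω => Z ω ^ 4) μ) (hK : ∫ ω, Z ω ^ 4 ∂μ ≤ K / n ^ 2)
    (hzero : ∫ ω, g ω ∂μ = 0) (hV : ∫ ω, ‖B (g ω)‖ ^ 2 ∂μ ≤ V / n)
    (hW : ‖∫ ω, A ω (B (g ω)) ∂μ‖ ≤ W / n) (hR : ∀ᵐ ω ∂μ, ‖Δ ω‖ ≤ R)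
    (h1 : ∀ᵐ ω ∂μ, ‖Δ ω + B (g ω)‖ ≤ C₁ * Z ω ^ 2)
    (h2 : ∀ᵐ ω ∂μ, ‖Δ ω + B (g ω) - B (A ω (B (g ω)))‖ ≤ C₂ * Z ω ^ 3 + c * ‖Δ ω‖ ^ 2) :
    ∫ ω, ‖Δ ω‖ ^ 2 ∂μ ≤ 2 * V / n + 2 * C₁ ^ 2 * K / n ^ 2 ∧
      ‖∫ ω, Δ ω ∂μ‖ ≤ κ * W / n + 2 * c * V / n
        + (C₂ * (K + 1) + 2 * c * C₁ ^ 2 * K) / (n * √n) := by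
  have hn0 : 0 < n := by linarith
  have hZ0 : ∀ ω, 0 ≤ Z ω := fun ω => (norm_nonneg _).trans (hgZ ω)
  have iZ : ∀ k ≤ 4, Integrable (fun ω => Z ω ^ k) μ := fun k hk =>
    integrable_pow_of_le hZ.aestronglyMeasurable hk hZ4
  have ig : Integrable g μ := (iZ 1 (by norm_num)).mono' hg.aestronglyMeasurable
    (Filter.Eventually.of_forall fun ω => by simpa using hgZ ω)
  have hBg : StronglyMeasurable (fun ω => B (g ω)) := B.continuous.comp_stronglyMeasurable hg
  have hABg : StronglyMeasurable (fun ω => A ω (B (g ω))) :=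
    (ContinuousLinearMap.id ℝ ((𝔼 d) →L[ℝ] (𝔼 d))).continuous₂.comp_stronglyMeasurable
      (hA.prodMk hBg)
  have iBg : Integrable (fun ω => B (g ω)) μ := B.integrable_comp ig
  have nBg : ∀ ω, ‖B (g ω)‖ ≤ κ * Z ω := fun ω =>
    (hB _).trans (mul_le_mul_of_nonneg_left (hgZ ω) hκ)
  have iBg2 : Integrable (fun ω => ‖B (g ω)‖ ^ 2) μ :=
    ((iZ 2 (by norm_num)).const_mul (κ ^ 2)).mono' (hBg.norm.pow 2).aestronglyMeasurable
      (Filter.Eventually.of_forall fun ω => by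
        rw [Real.norm_of_nonneg (by positivity), ← mul_pow]
        exact pow_le_pow_left₀ (norm_nonneg _) (nBg ω) 2)
  have iABg : Integrable (fun ω => A ω (B (g ω))) μ :=
    ((iZ 2 (by norm_num)).const_mul κ).mono' hABg.aestronglyMeasurable
      (Filter.Eventually.of_forall fun ω => by
        refine ((A ω).le_opNorm _).trans ?_
        calc ‖A ω‖ * ‖B (g ω)‖ ≤ Z ω * (κ * Z ω) :=
              mul_le_mul (hAZ ω) (nBg ω) (norm_nonneg _) (hZ0 ω)
          _ = κ * Z ω ^ 2 := by ring)
  have iBABg : Integrable (fun ω => B (A ω (B (g ω)))) μ := B.integrable_comp iABg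
  have iΔ : Integrable Δ μ := (integrable_const R).mono' hΔ.aestronglyMeasurable hR
  have iΔ2 : Integrable (fun ω => ‖Δ ω‖ ^ 2) μ :=
    (integrable_const (R ^ 2)).mono' (hΔ.norm.pow 2).aestronglyMeasurable (by
      filter_upwards [hR] with ω h
      rw [Real.norm_of_nonneg (by positivity)]
      exact pow_le_pow_left₀ (norm_nonneg _) h 2)
  -- The leading factor 2 of the theorem arises here, from `(a + b)² ≤ 2a² + 2b²`.
  have var : ∫ ω, ‖Δ ω‖ ^ 2 ∂μ ≤ 2 * V / n + 2 * C₁ ^ 2 * K / n ^ 2 := by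
    have hpt : ∀ᵐ ω ∂μ, ‖Δ ω‖ ^ 2 ≤ 2 * ‖B (g ω)‖ ^ 2 + 2 * C₁ ^ 2 * Z ω ^ 4 := by
      filter_upwards [h1] with ω h
      have a1 : ‖Δ ω‖ ≤ ‖Δ ω + B (g ω)‖ + ‖B (g ω)‖ := by
        simpa using norm_sub_le (Δ ω + B (g ω)) (B (g ω))
      have a2 : ‖Δ ω + B (g ω)‖ ^ 2 ≤ (C₁ * Z ω ^ 2) ^ 2 :=
        pow_le_pow_left₀ (norm_nonneg _) h 2
      have a3 : ‖Δ ω‖ ^ 2 ≤ (‖Δ ω + B (g ω)‖ + ‖B (g ω)‖) ^ 2 :=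
        pow_le_pow_left₀ (norm_nonneg _) a1 2
      nlinarith [sq_nonneg (‖Δ ω + B (g ω)‖ - ‖B (g ω)‖)]
    refine (integral_mono_ae iΔ2 ((iBg2.const_mul 2).add (hZ4.const_mul (2 * C₁ ^ 2))) hpt).trans ?_
    simp only [Pi.add_apply]
    rw [integral_add (iBg2.const_mul 2) (hZ4.const_mul (2 * C₁ ^ 2)), integral_const_mul,
      integral_const_mul]
    have a1 : 2 * C₁ ^ 2 * ∫ ω, Z ω ^ 4 ∂μ ≤ 2 * C₁ ^ 2 * (K / n ^ 2) := by gcongr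
    calc _ ≤ 2 * (V / n) + 2 * C₁ ^ 2 * (K / n ^ 2) := by linarith
      _ = _ := by ring
  refine ⟨var, ?_⟩
  have hK0 : 0 ≤ K := by
    have : 0 ≤ K / n ^ 2 := (integral_nonneg fun ω => by positivity).trans hK
    by_contra! h
    exact absurd (div_neg_of_neg_of_pos h (by positivity)) this.not_gt
  have hs : 1 ≤ √n := Real.one_le_sqrt.2 hn
  have hZ3 : ∫ ω, Z ω ^ 3 ∂μ ≤ (K + 1) / (n * √n) := by
    have hi : Integrable (fun ω => √n * Z ω ^ 4 + 1 / (n * √n)) μ :=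
      (hZ4.const_mul _).add (integrable_const _)
    refine (integral_mono (iZ 3 (by norm_num)) hi fun ω => pow_three_le_sqrt_mul hn0 (hZ0 ω)).trans ?_
    rw [integral_add (hZ4.const_mul _) (integrable_const _), integral_const_mul]
    simp only [integral_const, probReal_univ, one_smul]
    have a1 : √n * ∫ ω, Z ω ^ 4 ∂μ ≤ √n * (K / n ^ 2) := by gcongr
    have a2 : √n * (K / n ^ 2) = K / (n * √n) := by
      have := Real.mul_self_sqrt hn0.le
      field_simp
      rw [pow_two, this, mul_comm]
    calc _ ≤ K / (n * √n) + 1 / (n * √n) := by linarith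
      _ = _ := by ring
  -- The linear term drops out because `g` is centred, leaving the remainder and the score–Hessian
  -- correlation.
  have hdec : ∫ ω, Δ ω ∂μ = ∫ ω, (Δ ω + B (g ω) - B (A ω (B (g ω)))) ∂μ
      + B (∫ ω, A ω (B (g ω)) ∂μ) := by
    have iΔB : Integrable (fun ω => Δ ω + B (g ω)) μ := iΔ.add iBg
    rw [integral_sub iΔB iBABg, integral_add iΔ iBg, B.integral_comp_comm ig, hzero,
      B.integral_comp_comm iABg]
    simp
  have hrem : ‖∫ ω, (Δ ω + B (g ω) - B (A ω (B (g ω)))) ∂μ‖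
      ≤ C₂ * ((K + 1) / (n * √n)) + c * (2 * V / n + 2 * C₁ ^ 2 * K / n ^ 2) := by
    have i3 := (iZ 3 (by norm_num)).const_mul C₂
    refine (norm_integral_le_of_norm_le (i3.add (iΔ2.const_mul c)) h2).trans ?_
    simp only [Pi.add_apply]
    rw [integral_add i3 (iΔ2.const_mul c), integral_const_mul, integral_const_mul]
    gcongr
  have hn2 : 1 / n ^ 2 ≤ 1 / (n * √n) := by
    apply one_div_le_one_div_of_le (by positivity)
    have : √n ≤ n := by nlinarith [Real.mul_self_sqrt hn0.le]
    nlinarith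
  calc ‖∫ ω, Δ ω ∂μ‖ ≤ (C₂ * ((K + 1) / (n * √n)) + c * (2 * V / n + 2 * C₁ ^ 2 * K / n ^ 2))
        + κ * (W / n) := by
        rw [hdec]
        refine (norm_add_le _ _).trans (add_le_add hrem ((hB _).trans ?_))
        gcongr
    _ = κ * W / n + 2 * c * V / n + C₂ * (K + 1) / (n * √n)
        + 2 * c * C₁ ^ 2 * K * (1 / n ^ 2) := by ring
    _ ≤ κ * W / n + 2 * c * V / n + C₂ * (K + 1) / (n * √n)
        + 2 * c * C₁ ^ 2 * K * (1 / (n * √n)) := by gcongr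
    _ = _ := by ring

end Perturbation

/-! ### Error and bias of one machine. -/

section SingleMachine

local notation "𝔼" d => EuclideanSpace ℝ (Fin d)

lemma pow_four_add_three_le (a b c : ℝ) :
    (a + b + c) ^ 4 ≤ 27 * (a ^ 4 + b ^ 4 + c ^ 4) := by
  have h : ∀ x y z : ℝ, (x + y + z) ^ 2 ≤ 3 * (x ^ 2 + y ^ 2 + z ^ 2) := fun x y z => by
    nlinarith [sq_nonneg (x - y), sq_nonneg (y - z), sq_nonneg (x - z)]
  have h1 := pow_le_pow_left₀ (sq_nonneg _) (h a b c) 2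
  have h2 := h (a ^ 2) (b ^ 2) (c ^ 2)
  nlinarith

/-- The columns reduce an operator average to vector averages. The powers of `d` lost here affect
only the constants of the order terms. -/
lemma opNorm_pow_four_le {d : ℕ} (A : (𝔼 d) →L[ℝ] (𝔼 d)) :
    ‖A‖ ^ 4 ≤ (d : ℝ) ^ 3 * ∑ j, ‖A (EuclideanSpace.single j 1)‖ ^ 4 := by
  have h1 : ‖A‖ ≤ ∑ j, ‖A (EuclideanSpace.single j 1)‖ := by
    refine A.opNorm_le_bound (Finset.sum_nonneg fun _ _ => norm_nonneg _) fun v => ?_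
    have hv : v = ∑ i, v i • EuclideanSpace.single i (1 : ℝ) := by
      ext k; simp [Pi.single_apply]
    conv_lhs => rw [hv, map_sum]
    rw [Finset.sum_mul]
    refine norm_sum_le_of_le _ fun i _ => ?_
    rw [map_smul, norm_smul, mul_comm]
    gcongr
    exact PiLp.norm_apply_le v i
  set x : Fin d → ℝ := fun j => ‖A (EuclideanSpace.single j 1)‖
  have h2 : (∑ j, x j) ^ 2 ≤ d * ∑ j, x j ^ 2 := by
    simpa using sq_sum_le_card_mul_sum_sq (s := Finset.univ) (f := x)
  have h3 : (∑ j, x j ^ 2) ^ 2 ≤ d * ∑ j, x j ^ 4 := by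
    have := sq_sum_le_card_mul_sum_sq (s := Finset.univ) (f := fun j => x j ^ 2)
    simpa only [← pow_mul, Nat.reduceMul, Finset.card_univ, Fintype.card_fin] using this
  calc ‖A‖ ^ 4 ≤ (∑ j, x j) ^ 4 := by gcongr
    _ = ((∑ j, x j) ^ 2) ^ 2 := by ring
    _ ≤ (d * ∑ j, x j ^ 2) ^ 2 := by gcongr
    _ = (d : ℝ) ^ 2 * (∑ j, x j ^ 2) ^ 2 := by ring
    _ ≤ (d : ℝ) ^ 2 * (d * ∑ j, x j ^ 4) := by gcongr
    _ = (d : ℝ) ^ 3 * ∑ j, x j ^ 4 := by ring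

/-- Fourth moments of the averages that control the estimation error. -/
lemma fourth_moment_score_hessian_lipschitz_le {d n : ℕ} {Ω 𝒳 : Type*} [MeasurableSpace Ω]
    {μ : Measure Ω} [MeasurableSpace 𝒳] {P : Measure 𝒳} [IsProbabilityMeasure P]
    {X : Fin n → Ω → 𝒳} (hn : 0 < n)
    (hX : ∀ j, Measurable (X j)) (hlaw : ∀ j, μ.map (X j) = P) (hind : iIndepFun X μ)
    {φ : 𝒳 → 𝔼 d} {A : 𝒳 → (𝔼 d) →L[ℝ] (𝔼 d)} {q : 𝒳 → ℝ} {G H L : ℝ} (hφ : Measurable φ)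
    (hA : StronglyMeasurable A) (hq : Measurable q) (hφ0 : ∫ x, φ x ∂P = 0)
    (hA0 : ∫ x, A x ∂P = 0) (hq0 : ∫ x, q x ∂P = 0) (hAi : Integrable A P)
    (hφ4 : Integrable (fun x => ‖φ x‖ ^ 4) P) (hA4 : Integrable (fun x => ‖A x‖ ^ 4) P)
    (hq4 : Integrable (fun x => q x ^ 4) P) (hG : ∫ x, ‖φ x‖ ^ 4 ∂P ≤ G ^ 4)
    (hH : ∫ x, ‖A x‖ ^ 4 ∂P ≤ H ^ 4) (hL : ∫ x, q x ^ 4 ∂P ≤ L ^ 4) :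
    Integrable (fun ω => (‖(1 / (n : ℝ)) • ∑ j, φ (X j ω)‖ + ‖(1 / (n : ℝ)) • ∑ j, A (X j ω)‖
      + |1 / (n : ℝ) * ∑ j, q (X j ω)|) ^ 4) μ ∧
    ∫ ω, (‖(1 / (n : ℝ)) • ∑ j, φ (X j ω)‖ + ‖(1 / (n : ℝ)) • ∑ j, A (X j ω)‖
      + |1 / (n : ℝ) * ∑ j, q (X j ω)|) ^ 4 ∂μ
      ≤ 81 * (d ^ 2 * G ^ 4 + d ^ 6 * H ^ 4 + L ^ 4) / (n : ℝ) ^ 2 := by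
  obtain ⟨g1, g2⟩ := fourth_moment_norm_empirical_average_le hn hX hlaw hind hφ hφ0 hφ4 hG
  obtain ⟨q1, q2⟩ := fourth_moment_empirical_average_le hn hX hlaw hind hq hq0 hq4 hL
  have hAe : ∀ k : Fin d, StronglyMeasurable (fun x => A x (EuclideanSpace.single k 1)) := fun k =>
    (ContinuousLinearMap.apply ℝ (𝔼 d)
      (EuclideanSpace.single k (1 : ℝ))).continuous.comp_stronglyMeasurable hA
  have hAle : ∀ (k : Fin d) (x : 𝒳), ‖A x (EuclideanSpace.single k 1)‖ ^ 4 ≤ ‖A x‖ ^ 4 :=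
    fun k x => by
      refine pow_le_pow_left₀ (norm_nonneg _) ?_ 4
      simpa using (A x).le_opNorm (EuclideanSpace.single k (1 : ℝ))
  have hA4e : ∀ k : Fin d, Integrable (fun x => ‖A x (EuclideanSpace.single k 1)‖ ^ 4) P :=
    fun k => hA4.mono' ((hAe k).norm.pow 4).aestronglyMeasurable
      (Filter.Eventually.of_forall fun x => by
        rw [Real.norm_of_nonneg (by positivity)]; exact hAle k x)
  have key : ∀ k : Fin d, _ := fun k => fourth_moment_norm_empirical_average_le hn hX hlaw hind
    (φ := fun x => A x (EuclideanSpace.single k 1)) (M := H ^ 4) (hAe k).measurable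
    (by rw [← ContinuousLinearMap.integral_apply hAi, hA0]; simp) (hA4e k)
    ((integral_mono (hA4e k) hA4 (hAle k)).trans hH)
  set gg : Ω → ℝ := fun ω => ‖(1 / (n : ℝ)) • ∑ j, φ (X j ω)‖ with hgg
  set aa : Ω → ℝ := fun ω => ‖(1 / (n : ℝ)) • ∑ j, A (X j ω)‖ with haa
  set qq : Ω → ℝ := fun ω => 1 / (n : ℝ) * ∑ j, q (X j ω) with hqq
  have hapw : ∀ ω, aa ω ^ 4 ≤ (d : ℝ) ^ 3 * ∑ k : Fin d,
      ‖(1 / (n : ℝ)) • ∑ j, A (X j ω) (EuclideanSpace.single k 1)‖ ^ 4 := fun ω => by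
    refine (opNorm_pow_four_le _).trans_eq ?_
    simp
  have ham : StronglyMeasurable aa := by
    refine StronglyMeasurable.norm ?_
    exact (Finset.stronglyMeasurable_fun_sum _ fun j _ =>
      hA.comp_measurable (hX j)).const_smul (1 / (n : ℝ))
  have hsum : Integrable (fun ω => (d : ℝ) ^ 3 * ∑ k : Fin d,
      ‖(1 / (n : ℝ)) • ∑ j, A (X j ω) (EuclideanSpace.single k 1)‖ ^ 4) μ :=
    (integrable_finsetSum _ fun k _ => (key k).1).const_mul _
  have a1 : Integrable (fun ω => aa ω ^ 4) μ :=
    hsum.mono' (ham.pow 4).aestronglyMeasurable (Filter.Eventually.of_forall fun ω => by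
      rw [Real.norm_of_nonneg (by positivity)]; exact hapw ω)
  have a2 : ∫ ω, aa ω ^ 4 ∂μ ≤ (d : ℝ) ^ 3 * (d * (3 * (d : ℝ) ^ 2 * H ^ 4 / (n : ℝ) ^ 2)) := by
    refine (integral_mono a1 hsum hapw).trans ?_
    rw [integral_const_mul, integral_finsetSum _ fun k _ => (key k).1]
    gcongr
    refine (Finset.sum_le_sum fun k _ => (key k).2).trans_eq ?_
    simp
  have hgm : Measurable gg :=
    ((Finset.measurable_sum _ fun j _ => hφ.comp (hX j)).const_smul (1 / (n : ℝ))).norm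
  have hqm : Measurable qq :=
    (Finset.measurable_sum _ fun j _ => hq.comp (hX j)).const_mul (1 / (n : ℝ))
  have hpt : ∀ ω, (gg ω + aa ω + |qq ω|) ^ 4 ≤ 27 * (gg ω ^ 4 + aa ω ^ 4 + qq ω ^ 4) := fun ω => by
    have := pow_four_add_three_le (gg ω) (aa ω) |qq ω|
    rwa [Even.pow_abs (by decide : Even 4)] at this
  have s1 : Integrable (fun ω => gg ω ^ 4 + aa ω ^ 4) μ := g1.add a1
  have s2 : Integrable (fun ω => 27 * (gg ω ^ 4 + aa ω ^ 4 + qq ω ^ 4)) μ :=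
    (s1.add q1).const_mul 27
  have hI : Integrable (fun ω => (gg ω + aa ω + |qq ω|) ^ 4) μ :=
    s2.mono' ((((hgm.stronglyMeasurable.add ham).add
      hqm.abs.stronglyMeasurable).pow 4).aestronglyMeasurable)
      (Filter.Eventually.of_forall fun ω => by
        rw [Real.norm_of_nonneg (by positivity)]; exact hpt ω)
  refine ⟨hI, (integral_mono hI s2 hpt).trans ?_⟩
  rw [integral_const_mul, integral_add s1 q1, integral_add g1 a1]
  calc _ ≤ 27 * (3 * (d : ℝ) ^ 2 * G ^ 4 / (n : ℝ) ^ 2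
        + (d : ℝ) ^ 3 * (d * (3 * (d : ℝ) ^ 2 * H ^ 4 / (n : ℝ) ^ 2))
        + 3 * L ^ 4 / (n : ℝ) ^ 2) := by gcongr
    _ = _ := by ring

lemma integral_empirical_average_eq_zero {d n : ℕ} {Ω 𝒳 : Type*} [MeasurableSpace Ω]
    {μ : Measure Ω} [MeasurableSpace 𝒳] {P : Measure 𝒳} {X : Fin n → Ω → 𝒳}
    (hX : ∀ j, Measurable (X j)) (hlaw : ∀ j, μ.map (X j) = P) {φ : 𝒳 → 𝔼 d}
    (hφ : Integrable φ P) (hφ0 : ∫ x, φ x ∂P = 0) :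
    ∫ ω, (1 / (n : ℝ)) • ∑ j, φ (X j ω) ∂μ = 0 := by
  have h : ∀ j, Integrable (fun ω => φ (X j ω)) μ := fun j => by
    rw [← hlaw j] at hφ
    exact hφ.comp_measurable (hX j)
  rw [integral_smul, integral_finsetSum _ fun j _ => h j]
  refine smul_eq_zero_of_right _ (Finset.sum_eq_zero fun j _ => ?_)
  rw [← integral_map (f := φ) (hX j).aemeasurable (by rw [hlaw]; exact hφ.1), hlaw, hφ0]

/-- Expansion of the empirical risk minimizer when the score, the Hessian and the Lipschitz constant
of the empirical risk are close to their expectations. -/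
lemma expansion_of_isMinOn {d n : ℕ} {𝒳 : Type*} [MeasurableSpace 𝒳] {P : Measure 𝒳}
    {Θ : Set (𝔼 d)} {θs θh : 𝔼 d} {f : (𝔼 d) → 𝒳 → ℝ} {R ρ lam G H L l δ τ : ℝ}
    (hP : ParameterAssumption Θ f P θs R) (hC : LocalStrongConvexity f P θs ρ lam)
    (hS : SmoothnessAssumption Θ f P θs ρ G H L) (hn : 0 < n) (hL : 0 ≤ L) {Lip : 𝒳 → ℝ}
    (hLip : ∀ x, ∀ θ ∈ Metric.ball θs ρ, ∀ θ' ∈ Metric.ball θs ρ,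
      ‖hessian (fun η => f η x) θ' - hessian (fun η => f η x) θ‖ ≤ Lip x * ‖θ' - θ‖)
    (hl : l ≤ L) (s : Fin n → 𝒳) (hδ : 0 < δ) (hδρ : δ ≤ ρ / 2) (hδL : δ ≤ lam / (4 * (L + 1)))
    (hτ1 : τ ≤ 1) (hτ2 : τ ≤ lam / 4) (hτ3 : τ ≤ lam * δ / 4)
    (hθ : θh ∈ Θ) (hmin : IsMinOn (empRisk f s) Θ θh)
    (hZ : ‖(1 / (n : ℝ)) • ∑ j, gradient (fun η => f η (s j)) θs‖
      + ‖(1 / (n : ℝ)) • ∑ j, (hessian (fun η => f η (s j)) θs - hessian (popRisk f P) θs)‖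
      + |1 / (n : ℝ) * ∑ j, (Lip (s j) - l)| ≤ τ) :
    ‖θh - θs‖ ≤ 2 / lam * ‖(1 / (n : ℝ)) • ∑ j, gradient (fun η => f η (s j)) θs‖ ∧
      ‖(1 / (n : ℝ)) • ∑ j, gradient (fun η => f η (s j)) θs + (hessian (popRisk f P) θs
        + (1 / (n : ℝ)) • ∑ j, (hessian (fun η => f η (s j)) θs - hessian (popRisk f P) θs))
          (θh - θs)‖ ≤ (l + 1 / (n : ℝ) * ∑ j, (Lip (s j) - l)) * ‖θh - θs‖ ^ 2 := by
  have hn0 : (0 : ℝ) < n := by exact_mod_cast hn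
  have hθs := hS.mem_ball
  have hρ := hS.rho_pos
  have hlam := hC.lam_pos
  have hgrad : gradient (empRisk f s) θs = (1 / (n : ℝ)) • ∑ j, gradient (fun η => f η (s j)) θs :=
    (hasGradientAt_empRisk _ fun x => hS.differentiableAt x θs hθs).gradient
  have hhess : ∀ η ∈ Metric.ball θs ρ, hessian (empRisk f s) η
      = (1 / (n : ℝ)) • ∑ j, hessian (fun η => f η (s j)) η := fun η hη =>
    (hasFDerivAt_gradient_empRisk _ hS.differentiableAt hS.differentiableAt_gradient hη).fderiv
  have hhessA : hessian (empRisk f s) θs = hessian (popRisk f P) θs + (1 / (n : ℝ)) •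
      ∑ j, (hessian (fun η => f η (s j)) θs - hessian (popRisk f P) θs) := by
    rw [hhess θs hθs]
    simp only [Finset.sum_sub_distrib, smul_sub, Finset.sum_const, Finset.card_univ,
      Fintype.card_fin]
    rw [← Nat.cast_smul_eq_nsmul ℝ, smul_smul, one_div_mul_cancel hn0.ne', one_smul]
    abel
  have hmean : l + 1 / (n : ℝ) * ∑ j, (Lip (s j) - l) = 1 / (n : ℝ) * ∑ j, Lip (s j) := by
    simp only [Finset.sum_sub_distrib, Finset.sum_const, Finset.card_univ,
      Fintype.card_fin, nsmul_eq_mul]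
    field_simp; ring
  have hlip : ∀ η ∈ Metric.ball θs ρ, ‖hessian (empRisk f s) η - hessian (empRisk f s) θs‖
      ≤ (l + 1 / (n : ℝ) * ∑ j, (Lip (s j) - l)) * ‖η - θs‖ := fun η hη => by
    have e : hessian (empRisk f s) η - hessian (empRisk f s) θs = (1 / (n : ℝ)) •
        ∑ j, (hessian (fun η => f η (s j)) η - hessian (fun η => f η (s j)) θs) := by
      rw [hhess η hη, hhess θs hθs]
      simp only [Finset.sum_sub_distrib, smul_sub]
    rw [e, norm_smul, Real.norm_of_nonneg (by positivity), hmean, mul_assoc, Finset.sum_mul]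
    gcongr
    exact norm_sum_le_of_le _ fun j _ => hLip _ θs hθs η hη
  set g := (1 / (n : ℝ)) • ∑ j, gradient (fun η => f η (s j)) θs
  set A := (1 / (n : ℝ)) • ∑ j, (hessian (fun η => f η (s j)) θs - hessian (popRisk f P) θs)
  set ℓ := 1 / (n : ℝ) * ∑ j, (Lip (s j) - l)
  have p1 := norm_nonneg g
  have p2 := norm_nonneg A
  have p3 := abs_nonneg ℓ
  have p4 := le_abs_self ℓ
  -- The empirical Lipschitz constant is at most `L + 1` since `ℓ ≤ τ ≤ 1`, so the Hessian moves by
  -- at most `lam / 4` within distance `δ`.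
  have hδL' : (L + 1) * δ ≤ lam / 4 := by
    calc (L + 1) * δ ≤ (L + 1) * (lam / (4 * (L + 1))) := by gcongr
      _ = lam / 4 := by field_simp
  have hℓδ : (l + ℓ) * δ ≤ (L + 1) * δ := by gcongr; linarith
  have h := norm_sub_le_of_isMinOn (φ := empRisk f s) (ℓ := l + ℓ) (δ := δ)
    (S := hessian (popRisk f P) θs) (convexOn_empRisk _ hP.convex hP.convexOn_loss) hS.ball_subset
    (fun η hη => (hasGradientAt_empRisk _ fun x => hS.differentiableAt x η hη).differentiableAt)
    (fun η hη => (hasFDerivAt_gradient_empRisk _ hS.differentiableAt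
      hS.differentiableAt_gradient hη).differentiableAt)
    hlip hlam hC.curvature (by rw [hhessA, add_sub_cancel_left]; linarith) hδ (by linarith)
    (by linarith) (by rw [hgrad]; nlinarith) hθ hmin
  rwa [hgrad, hhessA] at h

set_option maxHeartbeats 400000 in
/-- Mean squared error and bias of the empirical risk minimizer of a single machine. -/
lemma exists_single_machine_bound (d : ℕ) {R ρ lam G H L : ℝ} (hR : 0 ≤ R) (hρ : 0 < ρ)
    (hlam : 0 < lam) (hL : 0 ≤ L) : ∃ K : ℝ, 0 ≤ K ∧
      ∀ {𝒳 : Type*} [MeasurableSpace 𝒳] {P : Measure 𝒳} [IsProbabilityMeasure P]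
        {Θ : Set (𝔼 d)} {θs : 𝔼 d} {f : (𝔼 d) → 𝒳 → ℝ},
        ParameterAssumption Θ f P θs R → LocalStrongConvexity f P θs ρ lam →
        SmoothnessAssumption Θ f P θs ρ G H L → (∀ θ ∈ Θ, Measurable (f θ)) →
        ∀ {B : (𝔼 d) →L[ℝ] (𝔼 d)}, (∀ w, ‖B w‖ ≤ lam⁻¹ * ‖w‖) →
        (∀ v, B (hessian (popRisk f P) θs v) = v) →
        ∀ {n : ℕ}, 0 < n → ∀ {Ω : Type*} [MeasurableSpace Ω] {μ : Measure Ω}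
          {X : Fin n → Ω → 𝒳} {θhat : Ω → 𝔼 d},
          (∀ j, Measurable (X j)) → (∀ j, μ.map (X j) = P) → iIndepFun X μ →
          IsEmpiricalMinimizer Θ f μ X θhat →
          ∫ ω, ‖θhat ω - θs‖ ^ 2 ∂μ
            ≤ 2 * (∫ x, ‖B (gradient (fun η => f η x) θs)‖ ^ 2 ∂P) / n + K / (n : ℝ) ^ 2 ∧
          ‖∫ ω, (θhat ω - θs) ∂μ‖
            ≤ lam⁻¹ * (H * √(∫ x, ‖B (gradient (fun η => f η x) θs)‖ ^ 2 ∂P)) / n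
              + 2 * (lam⁻¹ * L) * (∫ x, ‖B (gradient (fun η => f η x) θs)‖ ^ 2 ∂P) / n
              + K / (n * √n) := by
  -- `δ` is the localization radius. Below `τ`, the Lipschitz fluctuation is at most 1, the Hessian
  -- error at most `lam / 4`, and the score at most `lam * δ / 4`. Both depend only on `ρ`, `lam`
  -- and `L`.
  set δ := min (ρ / 2) (lam / (4 * (L + 1))) with hδ
  have hδ0 : 0 < δ := by positivity
  set τ := min 1 (min (lam / 4) (lam * δ / 4)) with hτ
  have hτ0 : 0 < τ := by positivity
  obtain ⟨C₁, C₂, hC₁, hC₂, hexp⟩ := exists_remainder_bounds hlam hR hL hτ0 (min_le_left _ _)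
  set M : ℝ := 81 * (d ^ 2 * G ^ 4 + d ^ 6 * H ^ 4 + L ^ 4) with hM
  have hM0 : 0 ≤ M := by positivity
  set c := lam⁻¹ * L with hc
  have hc0 : 0 ≤ c := by positivity
  -- The sum of the remainder constants of the mean squared error and of the bias, so that one
  -- constant serves both.
  refine ⟨2 * C₁ ^ 2 * M + (C₂ * (M + 1) + 2 * c * C₁ ^ 2 * M), by positivity, ?_⟩
  intro 𝒳 _ P _ Θ θs f hP hC hS hm B hB hBS n hn Ω _ μ X θhat hX hlaw hind hmin
  have := hind.isProbabilityMeasure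
  have hn' : (1 : ℝ) ≤ n := by exact_mod_cast hn
  have hn0 : (0 : ℝ) < n := by linarith
  have hθs := hS.mem_ball
  obtain ⟨Lip, hLipm, hLip, ⟨hL8, hL8'⟩, hLc8, hLc8'⟩ := hS.hessian_lipschitz
  set l := ∫ y, Lip y ∂P with hl
  have hlL : l ≤ L :=
    (moment_le_of_eighth_moment_le hL hLipm.aestronglyMeasurable hL8 hL8').2.2
  have hLi : Integrable Lip P := by
    simpa using integrable_pow_of_le hLipm.aestronglyMeasurable (show 1 ≤ 8 by norm_num) hL8
  set S := hessian (popRisk f P) θs with hSdef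
  set φ : 𝒳 → 𝔼 d := fun x => gradient (fun η => f η x) θs with hφ
  set Ah : 𝒳 → (𝔼 d) →L[ℝ] (𝔼 d) := fun x => hessian (fun η => f η x) θs - S with hAh
  set q : 𝒳 → ℝ := fun x => Lip x - l with hq
  have hφm : Measurable φ := hS.measurable_gradient hm hθs
  have hφi : Integrable φ P := hS.integrable_gradient hm hθs
  have hAm : StronglyMeasurable Ah :=
    (hS.stronglyMeasurable_hessian hm hθs).sub stronglyMeasurable_const
  have hAi : Integrable Ah P := (hS.integrable_hessian hm hθs).sub (integrable_const S)
  have hqm : Measurable q := hLipm.sub_const l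
  have hφ0 : ∫ x, φ x ∂P = 0 := by
    rw [← hS.gradient_popRisk hP hm hθs, hP.gradient_popRisk_eq_zero]
  have hA0 : ∫ x, Ah x ∂P = 0 := by
    rw [integral_sub (hS.integrable_hessian hm hθs) (integrable_const S),
      ← hS.hessian_popRisk hP hm]
    simp [hSdef]
  have hq0 : ∫ x, q x ∂P = 0 := by
    rw [integral_sub hLi (integrable_const l)]; simp [hl]
  obtain ⟨gm1, gm2⟩ := hS.gradient_moment θs hθs
  obtain ⟨hm1, hm2⟩ := hS.hessian_moment θs hθs
  have hφn := hφm.norm.aestronglyMeasurable (μ := P)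
  have hAn := hAm.norm.aestronglyMeasurable (μ := P)
  obtain ⟨hG4, -, -⟩ := moment_le_of_eighth_moment_le hS.G_nonneg hφn gm1 gm2
  obtain ⟨hH4, hH2, -⟩ := moment_le_of_eighth_moment_le hS.H_nonneg hAn hm1 hm2
  obtain ⟨hq4, -, -⟩ := moment_le_of_eighth_moment_le hL hqm.aestronglyMeasurable hLc8 hLc8'
  have n48 : (4 : ℕ) ≤ 8 := by norm_num
  have n28 : (2 : ℕ) ≤ 8 := by norm_num
  obtain ⟨hZ4, hZM⟩ := fourth_moment_score_hessian_lipschitz_le hn hX hlaw hind hφm hAm hqm hφ0 hA0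
    hq0 hAi (integrable_pow_of_le hφn n48 gm1) (integrable_pow_of_le hAn n48 hm1)
    (integrable_pow_of_le hqm.aestronglyMeasurable n48 hLc8) hG4 hH4 hq4
  have hBφm : Measurable (fun x => B (φ x)) := B.continuous.measurable.comp hφm
  have hBφ2 : Integrable (fun x => ‖B (φ x)‖ ^ 2) P := by
    refine ((integrable_pow_of_le hφn n28 gm1).const_mul (lam⁻¹ ^ 2)).mono'
      (hBφm.norm.pow_const 2).aestronglyMeasurable (Filter.Eventually.of_forall fun x => ?_)
    rw [Real.norm_of_nonneg (by positivity), ← mul_pow]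
    exact pow_le_pow_left₀ (norm_nonneg _) (hB _) 2
  have hBφ0 : ∫ x, B (φ x) ∂P = 0 := by rw [B.integral_comp_comm hφi, hφ0, map_zero]
  have hBφi : Integrable (fun x => B (φ x)) P := B.integrable_comp hφi
  set V := ∫ x, ‖B (φ x)‖ ^ 2 ∂P with hV
  set g : Ω → 𝔼 d := fun ω => (1 / (n : ℝ)) • ∑ j, φ (X j ω) with hg
  set A : Ω → (𝔼 d) →L[ℝ] (𝔼 d) := fun ω => (1 / (n : ℝ)) • ∑ j, Ah (X j ω) with hA
  set ℓ : Ω → ℝ := fun ω => 1 / (n : ℝ) * ∑ j, q (X j ω) with hℓ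
  have hBg : ∀ ω, B (g ω) = (1 / (n : ℝ)) • ∑ j, B (φ (X j ω)) := fun ω => by
    simp [hg, map_sum]
  have hgm : Measurable g :=
    (Finset.measurable_sum _ fun j _ => hφm.comp (hX j)).const_smul (1 / (n : ℝ))
  have hAmΩ : StronglyMeasurable A :=
    (Finset.stronglyMeasurable_fun_sum _ fun j _ =>
      hAm.comp_measurable (hX j)).const_smul (1 / (n : ℝ))
  have hℓm : Measurable ℓ :=
    (Finset.measurable_sum _ fun j _ => hqm.comp (hX j)).const_mul (1 / (n : ℝ))
  obtain ⟨T, hT, hθT⟩ := hmin.exists_estimator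
  have hθm : Measurable θhat := by
    have : θhat = fun ω => T (fun j => X j ω) := funext hθT
    rw [this]
    exact hT.comp (measurable_pi_lambda _ hX)
  have hRb : ∀ᵐ ω ∂μ, ‖θhat ω - θs‖ ≤ R := by
    filter_upwards [hmin.argmin] with ω hω
    exact hP.radius_le _ hω.1
  have hgood : ∀ᵐ ω ∂μ, ‖g ω‖ + ‖A ω‖ + |ℓ ω| ≤ τ → ‖θhat ω - θs‖ ≤ 2 / lam * ‖g ω‖ ∧
      ‖g ω + (S + A ω) (θhat ω - θs)‖ ≤ (l + ℓ ω) * ‖θhat ω - θs‖ ^ 2 := by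
    filter_upwards [hmin.argmin] with ω hω hZ
    exact expansion_of_isMinOn hP hC hS hn hL hLip hlL (fun j => X j ω) hδ0 (min_le_left _ _)
      (min_le_right _ _) (min_le_left _ _) ((min_le_right _ _).trans (min_le_left _ _))
      ((min_le_right _ _).trans (min_le_right _ _)) hω.1 hω.2 hZ
  have hVb : ∫ ω, ‖B (g ω)‖ ^ 2 ∂μ ≤ V / n := by
    have h := integral_norm_empirical_average_sq_le (φ := fun x => B (φ x)) hn hX hlaw hind hBφm
      hBφ0 hBφi hBφ2
    simpa only [hBg] using h
  -- Applying the correlation bound to `B ∘ φ` instead of `φ` keeps a factor `√V`, which later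
  -- becomes the Fisher trace.
  have hWb : ‖∫ ω, A ω (B (g ω)) ∂μ‖ ≤ H * √V / n := by
    have h := norm_integral_average_apply_average_le (φ := fun x => B (φ x)) hn hX hlaw hind hAm
      hBφm hAi hBφi hBφ0 (integrable_pow_of_le hAn n28 hm1) hBφ2
    have h' : √(∫ x, ‖Ah x‖ ^ 2 ∂P) * √V / n ≤ H * √V / n := by
      gcongr
      exact Real.sqrt_le_iff.2 ⟨hS.H_nonneg, hH2⟩
    simp only [← hBg] at h
    exact h.trans h'
  obtain ⟨v1, v2⟩ := expectation_bounds_of_expansion (g := g) (Δ := fun ω => θhat ω - θs) (A := A)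
    (B := B) (Z := fun ω => ‖g ω‖ + ‖A ω‖ + |ℓ ω|) (n := n) (C₁ := C₁) (C₂ := C₂) (c := c)
    (K := M) (V := V) (W := H * √V) (κ := lam⁻¹) (R := R) (μ := μ) hgm.stronglyMeasurable
    (hθm.sub_const θs).stronglyMeasurable hAmΩ
    ((hgm.norm.add hAmΩ.norm.measurable).add hℓm.abs) hn' hC₂ hc0 (inv_pos.2 hlam).le hB
    (fun ω => by
      have := norm_nonneg (A ω)
      have := abs_nonneg (ℓ ω)
      linarith)
    (fun ω => by
      have := norm_nonneg (g ω)
      have := abs_nonneg (ℓ ω)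
      linarith)
    hZ4 hZM
    (integral_empirical_average_eq_zero hX hlaw hφi hφ0)
    hVb hWb
    hRb
    (by
      filter_upwards [hRb, hgood] with ω h1 h2
      exact (hexp hB hBS h1 hlL h2).1)
    (by
      filter_upwards [hRb, hgood] with ω h1 h2
      exact (hexp hB hBS h1 hlL h2).2)
  exact ⟨v1.trans (add_le_add le_rfl (div_le_div_of_nonneg_right
      (le_add_of_nonneg_right (by positivity)) (by positivity))),
    v2.trans (add_le_add le_rfl (div_le_div_of_nonneg_right
      (le_add_of_nonneg_left (by positivity)) (by positivity)))⟩

end SingleMachine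

/-! ### Combination of the machines. -/

section Averaging

local notation "𝔼" d => EuclideanSpace ℝ (Fin d)

/-- A strongly monotone operator has a bounded inverse. -/
lemma exists_inverse_of_coercive {d : ℕ} {S : (𝔼 d) →L[ℝ] (𝔼 d)} {lam : ℝ} (hlam : 0 < lam)
    (hS : ∀ v, lam * ‖v‖ ^ 2 ≤ inner ℝ v (S v)) :
    ∃ B : (𝔼 d) →L[ℝ] (𝔼 d), (∀ w, ‖B w‖ ≤ lam⁻¹ * ‖w‖) ∧ ∀ v, B (S v) = v := by
  have hle : ∀ v, ‖v‖ ≤ lam⁻¹ * ‖S v‖ := fun v => by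
    rcases eq_or_ne v 0 with rfl | hv
    · simp
    have hp := norm_pos_iff.2 hv
    have h1 : ‖v‖ * (lam * ‖v‖) ≤ ‖v‖ * ‖S v‖ := by
      have := (hS v).trans (real_inner_le_norm v (S v))
      linarith
    rw [inv_mul_eq_div, le_div_iff₀ hlam, mul_comm]
    exact le_of_mul_le_mul_left h1 hp
  have hinj : Function.Injective S.toLinearMap := by
    rw [← LinearMap.ker_eq_bot, LinearMap.ker_eq_bot']
    intro v hv
    have := hle v
    rw [show S v = 0 from hv] at this
    simpa using this
  set e := LinearEquiv.ofInjectiveEndo S.toLinearMap hinj with he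
  have hB : ∀ v, e.symm (S v) = v := fun v => e.symm_apply_apply v
  have hB' : ∀ w, S (e.symm w) = w := fun w => e.apply_symm_apply w
  refine ⟨LinearMap.toContinuousLinearMap e.symm.toLinearMap, fun w => ?_, fun v => hB v⟩
  have := hle (e.symm w)
  rw [hB'] at this
  exact this

/-- The estimators are measurable functions of disjoint blocks of an independent family. -/
lemma indepFun_estimators {d m n : ℕ} {Ω 𝒳 : Type*} [MeasurableSpace Ω] [MeasurableSpace 𝒳]
    {μ : Measure Ω} {X : Fin m → Fin n → Ω → 𝒳} (hX : ∀ i j, Measurable (X i j))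
    (hind : iIndepFun (fun ij : Fin m × Fin n => X ij.1 ij.2) μ) {θhat : Fin m → Ω → 𝔼 d}
    (hθ : ∀ i, ∃ T : (Fin n → 𝒳) → 𝔼 d, Measurable T ∧ ∀ ω, θhat i ω = T (fun j => X i j ω))
    {i k : Fin m} (hik : i ≠ k) : IndepFun (θhat i) (θhat k) μ := by
  classical
  set s : Fin m → Finset (Fin m × Fin n) := fun i => Finset.univ.filter fun ij => ij.1 = i with hs
  have hdisj : Disjoint (s i) (s k) := by
    rw [Finset.disjoint_left]
    intro a ha hb
    simp only [hs, Finset.mem_filter, Finset.mem_univ, true_and] at ha hb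
    exact hik (ha.symm.trans hb)
  have hmem : ∀ i j, (i, j) ∈ s i := fun i j => by simp [hs]
  have h := hind.indepFun_finset (s i) (s k) hdisj fun ij => hX ij.1 ij.2
  obtain ⟨T, hT, hTe⟩ := hθ i
  obtain ⟨T', hT', hTe'⟩ := hθ k
  have := h.comp
    (φ := fun y : s i → 𝒳 => T fun j => y ⟨(i, j), hmem i j⟩)
    (ψ := fun y : s k → 𝒳 => T' fun j => y ⟨(k, j), hmem k j⟩)
    (hT.comp (measurable_pi_lambda _ fun j => measurable_pi_apply _))
    (hT'.comp (measurable_pi_lambda _ fun j => measurable_pi_apply _))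
  rw [show θhat i = _ from funext hTe, show θhat k = _ from funext hTe']
  exact this

/-- Collects the variance and the squared bias of the average into the final form of the bound. -/
lemma variance_add_sq_bias_le {m n d V T K G H L lam : ℝ} (hm : 0 < m) (hn : 0 < n)
    (hlam : 0 < lam) (hV : 0 ≤ V) (hVT : V ≤ T) (hVG : V ≤ (lam⁻¹) ^ 2 * G ^ 2) (hK : 0 ≤ K) :
    (2 * V / n + K / n ^ 2) / m
      + (lam⁻¹ * (H * √V) / n + 2 * (lam⁻¹ * L) * V / n + K / (n * √n)) ^ 2
      ≤ 2 / (m * n) * T + 16 * m ^ 2 * T / (lam ^ 2 * (m * n) ^ 2)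
        * (H ^ 2 * Real.log (max d 2) + L ^ 2 * G ^ 2 / lam ^ 2)
        + (K + 2 * K ^ 2) * (m / (m * n) ^ 2 + 1 / n ^ 3) := by
  set κ := lam⁻¹ with hκ
  have hκ0 : 0 < κ := inv_pos.2 hlam
  -- The `H ^ 2` term is obtained without a logarithm; the logarithm is inserted through this lower
  -- bound.
  have hlog : 1 / 2 ≤ Real.log (max d 2) := by
    have h1 : Real.log 2 ≤ Real.log (max d 2) := Real.log_le_log two_pos (le_max_right _ _)
    have := Real.log_two_gt_d9
    linarith
  set v := √V with hv
  have hvv : v ^ 2 = V := Real.sq_sqrt hV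
  have hT : 0 ≤ T := hV.trans hVT
  have hs : (√n) ^ 2 = n := Real.sq_sqrt hn.le
  have hs0 : 0 < √n := Real.sqrt_pos.2 hn
  have e1 : κ * (H * v) / n + 2 * (κ * L) * V / n + K / (n * √n)
      = κ * v / n * (H + 2 * L * v) + K / (n * √n) := by
    rw [← hvv]; ring
  -- In the squared bias the outer factor `V` is reserved for `V ≤ T`, while the `V` inside the
  -- bracket is bounded by `G² / lam²`.
  have b1 : (H + 2 * L * v) ^ 2 ≤ 2 * H ^ 2 + 8 * L ^ 2 * (κ ^ 2 * G ^ 2) := by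
    have h1 : (H + 2 * L * v) ^ 2 ≤ 2 * H ^ 2 + 8 * L ^ 2 * V := by
      rw [← hvv]; nlinarith [sq_nonneg (H - 2 * L * v)]
    have h2 : 8 * L ^ 2 * V ≤ 8 * L ^ 2 * (κ ^ 2 * G ^ 2) := by gcongr
    linarith
  have b2 : (κ * v / n * (H + 2 * L * v) + K / (n * √n)) ^ 2
      ≤ 2 * (κ ^ 2 * V / n ^ 2 * (2 * H ^ 2 + 8 * L ^ 2 * (κ ^ 2 * G ^ 2)))
        + 2 * (K ^ 2 / n ^ 3) := by
    have h1 : (κ * v / n * (H + 2 * L * v)) ^ 2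
        ≤ κ ^ 2 * V / n ^ 2 * (2 * H ^ 2 + 8 * L ^ 2 * (κ ^ 2 * G ^ 2)) := by
      have : (κ * v / n * (H + 2 * L * v)) ^ 2 = κ ^ 2 * V / n ^ 2 * (H + 2 * L * v) ^ 2 := by
        rw [← hvv]; ring
      rw [this]
      gcongr
    have h2 : (K / (n * √n)) ^ 2 = K ^ 2 / n ^ 3 := by
      rw [div_pow, mul_pow, hs]; ring
    nlinarith [sq_nonneg (κ * v / n * (H + 2 * L * v) - K / (n * √n))]
  have b3 : 2 * (κ ^ 2 * V / n ^ 2 * (2 * H ^ 2 + 8 * L ^ 2 * (κ ^ 2 * G ^ 2)))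
      ≤ 16 * κ ^ 2 * T / n ^ 2 * (H ^ 2 * Real.log (max d 2) + L ^ 2 * G ^ 2 * κ ^ 2) := by
    -- The numerical constant 16 of the theorem is dictated by the `L ^ 2` term.
    have h1 : 4 * H ^ 2 + 16 * L ^ 2 * (κ ^ 2 * G ^ 2)
        ≤ 16 * (H ^ 2 * Real.log (max d 2) + L ^ 2 * G ^ 2 * κ ^ 2) := by
      nlinarith [sq_nonneg H]
    calc _ = κ ^ 2 * V / n ^ 2 * (4 * H ^ 2 + 16 * L ^ 2 * (κ ^ 2 * G ^ 2)) := by ring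
      _ ≤ κ ^ 2 * T / n ^ 2 * (16 * (H ^ 2 * Real.log (max d 2) + L ^ 2 * G ^ 2 * κ ^ 2)) := by
        gcongr
      _ = _ := by ring
  have e2 : 16 * m ^ 2 * T / (lam ^ 2 * (m * n) ^ 2)
        * (H ^ 2 * Real.log (max d 2) + L ^ 2 * G ^ 2 / lam ^ 2)
      = 16 * κ ^ 2 * T / n ^ 2 * (H ^ 2 * Real.log (max d 2) + L ^ 2 * G ^ 2 * κ ^ 2) := by
    rw [hκ]; field_simp
  have e3 : m / (m * n) ^ 2 = 1 / (m * n ^ 2) := by field_simp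
  have b4 : (2 * V / n + K / n ^ 2) / m ≤ 2 / (m * n) * T + K * (1 / (m * n ^ 2)) := by
    have : (2 * V / n + K / n ^ 2) / m = 2 / (m * n) * V + K * (1 / (m * n ^ 2)) := by
      field_simp
    rw [this]
    gcongr
  rw [e1, e2, e3]
  have p1 : 0 ≤ 2 * K ^ 2 * (1 / (m * n ^ 2)) := by positivity
  have p2 : 0 ≤ K * (1 / n ^ 3) := by positivity
  have e4 : 2 * (K ^ 2 / n ^ 3) = 2 * K ^ 2 * (1 / n ^ 3) := by ring
  nlinarith

end Averaging

/-! ### The main theorem. -/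

theorem corollary2 :
    -- `c` is a numerical constant
    ∃ c : ℝ, 0 < c ∧
      -- `C` (the constant of the order terms) depends only on these parameters
      ∀ (d : ℕ) (R ρ lam G H L : ℝ), ∃ C : ℝ,
        ∀ (𝒳 : Type*) [MeasurableSpace 𝒳] (P : Measure 𝒳)
          (Θ : Set (EuclideanSpace ℝ (Fin d))) (θs : EuclideanSpace ℝ (Fin d))
          (f : EuclideanSpace ℝ (Fin d) → 𝒳 → ℝ)
          (ν : Measure 𝒳) (p : EuclideanSpace ℝ (Fin d) → 𝒳 → ℝ),
          ParameterAssumption Θ f P θs R →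
          LocalStrongConvexity f P θs ρ lam →
          SmoothnessAssumption Θ f P θs ρ G H L →
          -- the losses are the negative log-likelihoods of a parametric family, `P = P_{θs}`
          IsParametricFamily Θ ν p →
          (∀ θ ∈ Θ, ∀ x, f θ x = negLogLikelihood p θ x) →
          P = modelMeasure ν p θs →
          ∀ (m n N : ℕ), 0 < m → 0 < n → N = m * n →
          ∀ (Ω : Type*) [MeasurableSpace Ω] (μ : Measure Ω) [IsProbabilityMeasure μ]
            -- `X i j` is the `j`-th sample of machine `i`
            (X : Fin m → Fin n → Ω → 𝒳)
            (θhat : Fin m → Ω → EuclideanSpace ℝ (Fin d)),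
            (∀ i j, Measurable (X i j)) →
            (∀ i j, μ.map (X i j) = P) →
            iIndepFun (fun ij : Fin m × Fin n => X ij.1 ij.2) μ →
            (∀ i, IsEmpiricalMinimizer Θ f μ (X i) (θhat i)) →
            ∫ ω, ‖avgMixture θhat ω - θs‖ ^ 2 ∂μ ≤
              2 / (N : ℝ) * ((fisherInformation ν p θs)⁻¹).trace
              + c * (m : ℝ) ^ 2 * ((fisherInformation ν p θs)⁻¹).trace / (lam ^ 2 * (N : ℝ) ^ 2)
                * (H ^ 2 * Real.log (max (d : ℝ) 2) + L ^ 2 * G ^ 2 / lam ^ 2)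
              + C * ((m : ℝ) / (N : ℝ) ^ 2 + 1 / (n : ℝ) ^ 3) := by
  refine ⟨16, by norm_num, fun d R ρ lam G H L => ?_⟩
  -- The constant is chosen before the hypotheses are available. For parameters of the wrong sign
  -- the hypotheses are contradictory and any constant works.
  by_cases hpos : 0 ≤ R ∧ 0 < ρ ∧ 0 < lam ∧ 0 ≤ L
  swap
  · refine ⟨0, fun 𝒳 _ P Θ θs f ν p hP hC hS _ _ _ => absurd ⟨?_, hS.rho_pos, hC.lam_pos,
      hS.L_nonneg⟩ hpos⟩
    simpa using hP.radius_le θs (interior_subset hP.mem_interior)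
  obtain ⟨hR, hρ, hlam, hL⟩ := hpos
  obtain ⟨K, hK0, hK⟩ := exists_single_machine_bound d (G := G) (H := H) hR hρ hlam hL
  refine ⟨K + 2 * K ^ 2, ?_⟩
  intro 𝒳 _ P Θ θs f ν p hP hC hS hfam hf hPm m n N hm hn hN Ω _ μ _ X θhat hX hlaw hind hmin
  have hθs : θs ∈ Θ := interior_subset hP.mem_interior
  have : IsProbabilityMeasure P := hPm ▸ hfam.isProbabilityMeasure θs hθs
  have hmeas : ∀ θ ∈ Θ, Measurable (f θ) := fun θ hθ => by
    rw [show f θ = _ from funext (hf θ hθ)]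
    exact (hfam.measurable θ hθ).log.neg
  obtain ⟨B, hB, hBS⟩ := exists_inverse_of_coercive hlam hC.curvature
  set V := ∫ x, ‖B (gradient (fun η => f η x) θs)‖ ^ 2 ∂P with hV
  have hV0 : 0 ≤ V := integral_nonneg fun x => by positivity
  have hVT : V ≤ ((fisherInformation ν p θs)⁻¹).trace :=
    integral_norm_sq_le_trace_inv_fisherInformation hP hC hS hmeas hfam hf hPm hBS
  have hVG : V ≤ lam⁻¹ ^ 2 * G ^ 2 := by
    obtain ⟨g1, g2⟩ := hS.gradient_moment θs hS.mem_ball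
    have hgm := (hS.measurable_gradient hmeas hS.mem_ball)
    have hgn := hgm.norm.aestronglyMeasurable (μ := P)
    have h2 := (integrable_pow_of_le hgn (show 2 ≤ 8 by norm_num) g1).const_mul (lam⁻¹ ^ 2)
    refine (integral_mono_of_nonneg (Filter.Eventually.of_forall fun x => by positivity) h2
      (Filter.Eventually.of_forall fun x => ?_)).trans ?_
    · simp only [← mul_pow]
      exact pow_le_pow_left₀ (norm_nonneg _) (hB _) 2
    · rw [integral_const_mul]
      gcongr
      exact (moment_le_of_eighth_moment_le hS.G_nonneg hgn g1 g2).2.1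
  have hm' : (0 : ℝ) < m := by exact_mod_cast hm
  have hn' : (0 : ℝ) < n := by exact_mod_cast hn
  have key := fun i => hK hP hC hS hmeas hB hBS hn (hX i) (hlaw i)
    (hind.precomp (g := fun j : Fin n => (i, j)) fun a b h => (Prod.ext_iff.1 h).2) (hmin i)
  have hθm : ∀ i, Measurable (θhat i) := fun i => by
    obtain ⟨T, hT, hTe⟩ := (hmin i).exists_estimator
    rw [show θhat i = _ from funext hTe]
    exact hT.comp (measurable_pi_lambda _ (hX i))
  have hbd : ∀ i, ∀ᵐ ω ∂μ, ‖θhat i ω - θs‖ ≤ R := fun i => by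
    filter_upwards [(hmin i).argmin] with ω hω
    exact hP.radius_le _ hω.1
  have havg : ∀ ω, avgMixture θhat ω - θs = (1 / (m : ℝ)) • ∑ i, (θhat i ω - θs) := fun ω => by
    simp only [avgMixture, Finset.sum_sub_distrib, smul_sub, Finset.sum_const, Finset.card_univ,
      Fintype.card_fin]
    rw [← Nat.cast_smul_eq_nsmul ℝ, smul_smul, one_div_mul_cancel hm'.ne', one_smul]
  simp_rw [havg]
  refine (integral_norm_average_sq_le hm (Y := fun i ω => θhat i ω - θs)
    (fun i k hik => (indepFun_estimators hX hind (fun i => (hmin i).exists_estimator) hik).comp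
      (φ := fun y => y - θs) (ψ := fun y => y - θs) (by fun_prop) (by fun_prop))
    (fun i => (integrable_const R).mono' ((hθm i).sub_const θs).aestronglyMeasurable (hbd i))
    (fun i => (integrable_const (R ^ 2)).mono'
      (((hθm i).sub_const θs).norm.pow_const 2).aestronglyMeasurable (by
        filter_upwards [hbd i] with ω h
        rw [Real.norm_of_nonneg (by positivity)]
        exact pow_le_pow_left₀ (norm_nonneg _) h 2))
    (fun i => (key i).1) (fun i => (key i).2)).trans ?_
  subst hN
  push_cast
  exact variance_add_sq_bias_le hm' hn' hlam hV0 hVT hVG hK0
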